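/- Let $p,Q,r,s:\mathbb R\to\mathbb R$ satisfy $$\frac1{\sqrt{|p|}},\ \frac{Q}{\sqrt{|p|}},\ \frac{r}{\sqrt{|p|}}\in L^2_{\mathrm{loc}}(\mathbb R),\qquad s\in L^1_{\mathrm{loc}}(\mathbb R),\qquad \frac1p\neq 0\ \text{ a.e.},$$ and consider the formal expression $l[u]=-(pu')'+qu+i\big((ru)'+ru'\big)$ with $q=Q'+s$ in the sense of distributions. It is understood through the quasi-derivatives $$u^{[1]}:=pu'-(Q+ir)u,\qquad u^{[2]}:=\big(u^{[1]}\big)'+\frac{Q-ir}{p}\,u^{[1]}+\Big(\frac{Q^2+r^2}{p}-s\Big)u,\qquad l[u]:=-u^{[2]}.$$ In the complex Hilbert space $L^2(\mathbb R)$ let $\mathrm L$ be the maximal operator, $\mathrm Lu:=l[u]$ with $$\mathrm{Dom}(\mathrm L):=\{u\in L^2(\mathbb R)\mid u,u^{[1]}\in \mathrm{AC}_{\mathrm{loc}}(\mathbb R),\ l[u]\in L^2(\mathbb R)\},$$ and let $\mathrm L_{00}$ be the preminimal operator, the restriction of $\mathrm L$ to those $u\in\mathrm{Dom}(\mathrm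 L)$ whose support is compact. Assume in addition that (i) $p\in W^1_{2,\mathrm{loc}}(\mathbb R)$ and (the continuous representative of) $p$ is positive at every point of $\mathbb R$; (ii) $\displaystyle\int_{-\infty}^0 p^{-1/2}(t)\,dt=\int_0^\infty p^{-1/2}(t)\,dt=\infty$. If $\mathrm L_{00}$ is bounded from below, that is, for some $c\in\mathbb R$ one has $(\mathrm L_{00}u,u)\ge c\,(u,u)$ for all $u\in\mathrm{Dom}(\mathrm L_{00})$, then $\mathrm L_{00}$ is essentially self-adjoint (it is densely defined and symmetric, and its closure is self-adjoint), and $\mathrm L_{00}^*=\mathrm L=\mathrm L^*$. -/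

import Mathlib

open MeasureTheory Set Filter
open scoped ContDiff

noncomputable section

namespace SturmLiouville

/-- `f ∈ L²_loc(ℝ)`. -/
def MemL2Loc (f : ℝ → ℝ) : Prop :=
  ∀ K : Set ℝ, IsCompact K → MemLp f 2 (volume.restrict K)

/-- `f ∈ W¹_{2,loc}(ℝ)`: `f` and its weak (distributional) derivative belong to `L²_loc(ℝ)`. -/
def MemW12Loc (f : ℝ → ℝ) : Prop :=
  MemL2Loc f ∧ ∃ g : ℝ → ℝ, MemL2Loc g ∧
    ∀ φ : ℝ → ℝ, ContDiff ℝ ∞ φ → HasCompactSupport φ →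
      ∫ x, f x * deriv φ x = -∫ x, g x * φ x

/-- `u ∈ AC_loc(ℝ)`: absolutely continuous on every compact interval. -/
def ACLoc (u : ℝ → ℂ) : Prop :=
  ∀ a b : ℝ, AbsolutelyContinuousOnInterval u a b

/-- The conditions on the real coefficients `p, Q, r, s` of
`l[u] = -(pu')' + qu + i((ru)' + ru')`, where `q = Q' + s` in the sense of distributions. -/
structure CoeffConditions (p Q r s : ℝ → ℝ) : Prop where
  inv_sqrt : MemL2Loc fun x => 1 / √|p x|
  Q_div_sqrt : MemL2Loc fun x => Q x / √|p x|
  r_div_sqrt : MemL2Loc fun x => r x / √|p x|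
  s_loc : LocallyIntegrable s volume
  inv_ne_zero : ∀ᵐ x : ℝ, 1 / p x ≠ 0

/-- The first quasi-derivative `pu' - (Q + ir)u`, which is defined almost everywhere for
`u ∈ AC_loc`. -/
def quasiDeriv₁ (p Q r : ℝ → ℝ) (u : ℝ → ℂ) (x : ℝ) : ℂ :=
  (p x : ℂ) * deriv u x - ((Q x : ℂ) + Complex.I * (r x : ℂ)) * u x

/-- The second quasi-derivative `v' + ((Q - ir)/p) v + ((Q² + r²)/p - s) u`, where `v` is the
(absolutely continuous) first quasi-derivative of `u`. -/
def quasiDeriv₂ (p Q r s : ℝ → ℝ) (u v : ℝ → ℂ) (x : ℝ) : ℂ :=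
  deriv v x + ((Q x : ℂ) - Complex.I * (r x : ℂ)) / (p x : ℂ) * v x
    + (((Q x : ℂ) ^ 2 + (r x : ℂ) ^ 2) / (p x : ℂ) - (s x : ℂ)) * u x

/-- The Hilbert space `L²(ℝ)` of complex-valued functions. -/
abbrev L2 : Type := Lp ℂ 2 (volume : Measure ℝ)

/-- `f ∈ Dom(L)` and `L f = g`: the class `f` has a representative `u ∈ AC_loc`, its first
quasi-derivative is (a.e. equal to) some `v ∈ AC_loc`, and `g = l[u] = -u^{[2]}` in `L²(ℝ)`. -/
def IsMaximalPair (p Q r s : ℝ → ℝ) (f g : L2) : Prop :=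
  ∃ u v : ℝ → ℂ, ACLoc u ∧ ACLoc v ∧ f =ᵐ[volume] u ∧
    v =ᵐ[volume] quasiDeriv₁ p Q r u ∧
    g =ᵐ[volume] fun x => -quasiDeriv₂ p Q r s u v x

theorem ACLoc.continuous {u : ℝ → ℂ} (hu : ACLoc u) : Continuous u := by
  rw [continuous_iff_continuousAt]
  intro x
  refine (hu (x - 1) (x + 1)).continuousOn.continuousAt ?_
  rw [uIcc_of_le (by linarith)]
  exact Icc_mem_nhds (by linarith) (by linarith)

theorem ACLoc.ae_differentiableAt {u : ℝ → ℂ} (hu : ACLoc u) :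
    ∀ᵐ x : ℝ, DifferentiableAt ℝ u x := by
  have h : ∀ n : ℕ, ∀ᵐ x : ℝ, x ∈ uIcc (-(n : ℝ)) n → DifferentiableAt ℝ u x := fun n =>
    (hu _ _).boundedVariationOn.ae_differentiableAt_of_mem_uIcc
  filter_upwards [ae_all_iff.2 h] with x hx
  obtain ⟨n, hn⟩ := exists_nat_ge |x|
  refine hx n ?_
  rw [uIcc_of_le (by linarith [abs_nonneg x])]
  exact abs_le.1 hn

/-- The graph of the maximal operator. -/
def maximalGraph (p Q r s : ℝ → ℝ) : Submodule ℂ (L2 × L2) where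
  carrier := {z | IsMaximalPair p Q r s z.1 z.2}
  zero_mem' := by
    have h0 : ACLoc (fun _ => (0 : ℂ)) := fun a b =>
      contDiff_const.contDiffOn.absolutelyContinuousOnInterval
    refine ⟨fun _ => 0, fun _ => 0, h0, h0, Lp.coeFn_zero ℂ 2 volume, ?_, ?_⟩
    · exact Eventually.of_forall fun x => by simp [quasiDeriv₁]
    · filter_upwards [Lp.coeFn_zero ℂ 2 (volume : Measure ℝ)] with x _
      simp [quasiDeriv₂]
  add_mem' := by
    rintro ⟨f, g⟩ ⟨f', g'⟩ ⟨u, v, hu, hv, hf, h1, h2⟩ ⟨u', v', hu', hv', hf', h1', h2'⟩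
    refine ⟨u + u', v + v', fun a b => (hu a b).add (hu' a b), fun a b => (hv a b).add (hv' a b),
      (Lp.coeFn_add f f').trans (hf.add hf'), ?_, ?_⟩
    · filter_upwards [h1, h1', hu.ae_differentiableAt, hu'.ae_differentiableAt] with x e e' d d'
      simp only [Pi.add_apply, e, e', quasiDeriv₁, deriv_add d d']
      ring
    · filter_upwards [h2, h2', hv.ae_differentiableAt, hv'.ae_differentiableAt,
        Lp.coeFn_add g g'] with x e e' d d' ea
      simp only [Prod.mk_add_mk, ea, Pi.add_apply, e, e', quasiDeriv₂, deriv_add d d']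
      ring
  smul_mem' := by
    rintro c ⟨f, g⟩ ⟨u, v, hu, hv, hf, h1, h2⟩
    refine ⟨fun x => c • u x, fun x => c • v x, fun a b => (hu a b).const_smul c,
      fun a b => (hv a b).const_smul c, ?_, ?_, ?_⟩
    · filter_upwards [hf, Lp.coeFn_smul c f] with x e ea
      simp only [Prod.smul_mk, ea, Pi.smul_apply, e]
    · filter_upwards [h1, hu.ae_differentiableAt] with x e d
      have hd : deriv (fun x => c • u x) x = c • deriv u x := deriv_fun_const_smul c d
      simp only [quasiDeriv₁, hd, e]
      simp only [smul_eq_mul]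
      ring
    · filter_upwards [h2, hv.ae_differentiableAt, Lp.coeFn_smul c g] with x e d ea
      have hd : deriv (fun x => c • v x) x = c • deriv v x := deriv_fun_const_smul c d
      simp only [Prod.smul_mk, ea, Pi.smul_apply, e, quasiDeriv₂, hd]
      simp only [smul_eq_mul]
      ring

/-- `l[u]` is determined by the class of `u`, so `maximalGraph` is the graph of an operator. -/
theorem maximalGraph_snd_eq_zero (p Q r s : ℝ → ℝ) (z : L2 × L2)
    (hz : z ∈ maximalGraph p Q r s) (h0 : z.1 = 0) : z.2 = 0 := by
  obtain ⟨u, v, hu, hv, hf, h1, h2⟩ := hz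
  rw [h0] at hf
  have hu0 : u = 0 := by
    refine (hu.continuous.ae_eq_iff_eq volume continuous_zero).1 ?_
    exact hf.symm.trans (Lp.coeFn_zero ℂ 2 volume)
  subst hu0
  have hv0 : v = 0 := by
    refine (hv.continuous.ae_eq_iff_eq volume continuous_zero).1 ?_
    filter_upwards [h1] with x e
    rw [e]
    simp [quasiDeriv₁]
  subst hv0
  apply Lp.ext
  filter_upwards [h2, Lp.coeFn_zero ℂ 2 (volume : Measure ℝ)] with x e e0
  rw [e, e0]
  simp [quasiDeriv₂]

/-- The maximal operator `L` in `L²(ℝ)`: `L u = l[u]` on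
`{u ∈ L² | u, u^{[1]} ∈ AC_loc, l[u] ∈ L²}`. -/
def maximalOp (p Q r s : ℝ → ℝ) : L2 →ₗ.[ℂ] L2 :=
  (maximalGraph p Q r s).toLinearPMap

theorem mem_graph_maximalOp (p Q r s : ℝ → ℝ) (f g : L2) :
    (f, g) ∈ (maximalOp p Q r s).graph ↔ IsMaximalPair p Q r s f g := by
  rw [maximalOp, Submodule.toLinearPMap_graph_eq _ (maximalGraph_snd_eq_zero p Q r s)]
  rfl

/-- The classes in `L²(ℝ)` that vanish outside a compact set. (If such a class has a continuous
representative, then that representative has compact support.) -/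
def compactlySupported : Submodule ℂ L2 where
  carrier := {f | ∃ w : ℝ → ℂ, HasCompactSupport w ∧ f =ᵐ[volume] w}
  zero_mem' := ⟨0, HasCompactSupport.zero, Lp.coeFn_zero ℂ 2 volume⟩
  add_mem' := by
    rintro f g ⟨w, hw, hf⟩ ⟨w', hw', hg⟩
    exact ⟨w + w', hw.add hw', (Lp.coeFn_add f g).trans (hf.add hg)⟩
  smul_mem' := by
    rintro c f ⟨w, hw, hf⟩
    refine ⟨fun x => c • w x, hw.smul_left (f := fun _ => c), ?_⟩
    filter_upwards [hf, Lp.coeFn_smul c f] with x e ea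
    simp only [ea, Pi.smul_apply, e]

/-- The preminimal operator `L₀₀`: the restriction of `L` to the functions in `Dom(L)` with
compact support. -/
def preminimalOp (p Q r s : ℝ → ℝ) : L2 →ₗ.[ℂ] L2 :=
  (maximalOp p Q r s).domRestrict compactlySupported

/-- `(T u, u) ≥ c (u, u)` on `Dom(T)` for some real `c`. -/
def BoundedBelow (T : L2 →ₗ.[ℂ] L2) : Prop :=
  ∃ c : ℝ, ∀ u : T.domain, c * ‖(u : L2)‖ ^ 2 ≤ (inner ℂ (T u) (u : L2)).re

/-- A densely defined symmetric operator is essentially self-adjoint if its closure is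
self-adjoint. -/
structure EssentiallySelfAdjoint (T : L2 →ₗ.[ℂ] L2) : Prop where
  dense : Dense (T.domain : Set L2)
  symmetric : T.IsFormalAdjoint T
  closable : T.IsClosable
  closure_selfAdjoint : IsSelfAdjoint T.closure

end SturmLiouville

end

/-!
The formal expression is the first-order system `u' = p⁻¹ v + β u`, `v' = -conj β v - γ u - g`, with
`β = (Q + ir) / p`, `γ = (Q² + r²) / p - s` and `v = u^{[1]}`, whose coefficients are locally
integrable. Green's formula and the Carathéodory existence theorem for this system show that a pair
`(f, g)` with `(L₀₀ w, f) = (w, g)` for all `w` satisfies `L f = g`, so `L₀₀* = L`.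

A densely defined symmetric operator bounded below by `c` is essentially self-adjoint as soon as its
adjoint has no eigenvector for some `μ < c`. Let `L u = μ u`, and let `φ` be a cutoff whose
derivative is `p⁻¹ ψ`. Then `φ u` lies in the domain of `L₀₀`, and the localization formula
`(L (φ u), φ u) = μ ‖φ u‖² + ∫ p⁻¹ ψ² |u|²` bounds `(c - μ) ‖φ u‖²` by `∫ p⁻¹ ψ² |u|²`.
Take `φ = χ (P / N)`, where `P' = p⁻¹ ρ` and `ρ` is a smooth approximation of `√p`. Then
`p⁻¹ ψ² = O(N⁻²)`, while `P` tends to `±∞` at `±∞` because `∫ p^{-1/2}` diverges there; thus `φ` has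
compact support, and letting `N → ∞` gives `u = 0`.
-/

noncomputable section

namespace SturmLiouville

section LinearRelation

variable {𝕜 H : Type*} [RCLike 𝕜] [NormedAddCommGroup H] [InnerProductSpace 𝕜 H]

theorem isClosed_adjoint (S : Submodule 𝕜 (H × H)) : IsClosed (S.adjoint : Set (H × H)) := by
  have h : (S.adjoint : Set (H × H)) =
      ⋂ z ∈ S, {x : H × H | inner 𝕜 z.2 x.1 - inner 𝕜 z.1 x.2 = 0} := by
    ext x
    simp only [SetLike.mem_coe, Submodule.mem_adjoint_iff, mem_iInter, mem_ofPred_eq, Prod.forall]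
  rw [h]
  exact isClosed_biInter fun z _ => isClosed_eq (by fun_prop) continuous_const

theorem adjoint_topologicalClosure (S : Submodule 𝕜 (H × H)) :
    S.topologicalClosure.adjoint = S.adjoint := by
  ext x
  simp only [Submodule.mem_adjoint_iff]
  refine ⟨fun h a b hab => h a b (S.le_topologicalClosure hab), fun h a b hab => ?_⟩
  have hclosed : IsClosed {z : H × H | inner 𝕜 z.2 x.1 - inner 𝕜 z.1 x.2 = 0} :=
    isClosed_eq (by fun_prop) continuous_const
  exact closure_minimal (fun z hz => h z.1 z.2 hz) hclosed hab

theorem mul_norm_le_norm_sub_smul {c : ℝ} {f g : H}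
    (h : c * ‖f‖ ^ 2 ≤ RCLike.re (inner 𝕜 g f)) (μ : ℝ) :
    (c - μ) * ‖f‖ ≤ ‖g - (μ : 𝕜) • f‖ := by
  have hre : RCLike.re (inner 𝕜 (g - (μ : 𝕜) • f) f) = RCLike.re (inner 𝕜 g f) - μ * ‖f‖ ^ 2 := by
    rw [inner_sub_left, inner_smul_left, RCLike.conj_ofReal, map_sub, RCLike.re_ofReal_mul,
      inner_self_eq_norm_sq]
  have hCS : RCLike.re (inner 𝕜 (g - (μ : 𝕜) • f) f) ≤ ‖g - (μ : 𝕜) • f‖ * ‖f‖ :=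
    re_inner_le_norm _ _
  rcases (norm_nonneg f).eq_or_lt with h0 | h0
  · simp only [← h0, mul_zero, norm_nonneg]
  · refine le_of_mul_le_mul_right ?_ h0
    linarith

/-- The map `(f, g) ↦ g - μ f`, whose restriction to the graph of an operator `T` is `T - μ`. -/
def sndSubSMulFst (μ : 𝕜) : H × H →L[𝕜] H :=
  ContinuousLinearMap.snd 𝕜 H H - μ • ContinuousLinearMap.fst 𝕜 H H

@[simp]
theorem sndSubSMulFst_apply (μ : 𝕜) (z : H × H) : sndSubSMulFst μ z = z.2 - μ • z.1 := rfl

variable [CompleteSpace H]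

theorem isClosed_map_sndSubSMulFst {S : Submodule 𝕜 (H × H)} (hS : IsClosed (S : Set (H × H)))
    {μ : 𝕜} {k : ℝ} (hk : 0 < k) (hbound : ∀ z ∈ S, k * ‖z.1‖ ≤ ‖z.2 - μ • z.1‖) :
    IsClosed (S.map (sndSubSMulFst μ).toLinearMap : Set H) := by
  have : CompleteSpace S := hS.completeSpace_coe
  let D : S →L[𝕜] H := (sndSubSMulFst μ).comp S.subtypeL
  have hanti : AntilipschitzWith (1 + (1 + ‖μ‖) / k).toNNReal D := by
    refine AddMonoidHomClass.antilipschitz_of_bound D fun z => ?_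
    rw [Real.coe_toNNReal _ (by positivity)]
    set d : ℝ := ‖z.1.2 - μ • z.1.1‖
    have h1 : ‖z.1.1‖ ≤ d / k := (le_div_iff₀' hk).2 (hbound z.1 z.2)
    have h2 : ‖z.1.2‖ ≤ d + ‖μ‖ * (d / k) :=
      calc ‖z.1.2‖ = ‖(z.1.2 - μ • z.1.1) + μ • z.1.1‖ := by rw [sub_add_cancel]
        _ ≤ d + ‖μ‖ * ‖z.1.1‖ := (norm_add_le _ _).trans_eq (by rw [norm_smul])
        _ ≤ d + ‖μ‖ * (d / k) := by gcongr
    have hd0 : 0 ≤ d := norm_nonneg _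
    have hdk : 0 ≤ d / k := by positivity
    have hμ : 0 ≤ ‖μ‖ * (d / k) := by positivity
    calc ‖z‖ = max ‖z.1.1‖ ‖z.1.2‖ := rfl
      _ ≤ d + d / k + ‖μ‖ * (d / k) := max_le (by linarith) (by linarith)
      _ = (1 + (1 + ‖μ‖) / k) * d := by ring
  have hrange : (S.map (sndSubSMulFst μ).toLinearMap : Set H) = range D := by
    ext y; simp [D]
  rw [hrange]
  exact hanti.isClosed_range D.uniformContinuous

/-- `T - μ` has closed range, because `T` is bounded from below by `c > μ`, and dense range, because
`T* - μ` is injective. -/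
theorem topologicalClosure_eq_adjoint_of_ker {S : Submodule 𝕜 (H × H)} (hsymm : S ≤ S.adjoint)
    {c μ : ℝ} (hμ : μ < c) (hbound : ∀ z ∈ S, c * ‖z.1‖ ^ 2 ≤ RCLike.re (inner 𝕜 z.2 z.1))
    (hker : ∀ f : H, (f, (μ : 𝕜) • f) ∈ S.adjoint → f = 0) :
    S.topologicalClosure = S.adjoint := by
  have hle : S.topologicalClosure ≤ S.adjoint :=
    S.topologicalClosure_minimal hsymm (isClosed_adjoint S)
  refine le_antisymm hle fun z hz => ?_
  set R : Submodule 𝕜 H := S.topologicalClosure.map (sndSubSMulFst (μ : 𝕜)).toLinearMap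
  have hbound' : ∀ w ∈ S.topologicalClosure, (c - μ) * ‖w.1‖ ≤ ‖w.2 - (μ : 𝕜) • w.1‖ := by
    have hclosed : IsClosed {w : H × H | (c - μ) * ‖w.1‖ ≤ ‖w.2 - (μ : 𝕜) • w.1‖} :=
      isClosed_le (by fun_prop) (by fun_prop)
    exact closure_minimal (fun w hw => mul_norm_le_norm_sub_smul (hbound w hw) μ) hclosed
  have hRclosed : IsClosed (R : Set H) :=
    isClosed_map_sndSubSMulFst S.isClosed_topologicalClosure (sub_pos.2 hμ) hbound'
  have hRtop : R = ⊤ := by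
    rw [← hRclosed.submodule_topologicalClosure_eq, Submodule.topologicalClosure_eq_top_iff,
      Submodule.eq_bot_iff]
    intro f hf
    refine hker f ((Submodule.mem_adjoint_iff _ _).2 fun a b hab => ?_)
    have h : inner 𝕜 (b - (μ : 𝕜) • a) f = 0 :=
      (Submodule.mem_orthogonal R f).1 hf _ ⟨(a, b), S.le_topologicalClosure hab, rfl⟩
    rwa [inner_sub_left, inner_smul_left, RCLike.conj_ofReal, ← inner_smul_right] at h
  obtain ⟨w, hw, hwz⟩ : sndSubSMulFst (μ : 𝕜) z ∈ R := hRtop ▸ Submodule.mem_top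
  have hsub : (z - w).2 = (μ : 𝕜) • (z - w).1 := by
    rw [← sub_eq_zero, ← sndSubSMulFst_apply, map_sub]
    exact sub_eq_zero.2 hwz.symm
  have hmem : z - w ∈ S.adjoint := S.adjoint.sub_mem hz (hle hw)
  have hfst : (z - w).1 = 0 := hker _ (by rwa [← hsub])
  have hzw : z = w := sub_eq_zero.1 (Prod.ext hfst (by rw [hsub, hfst, smul_zero]; rfl))
  exact hzw ▸ hw

theorem dense_domain_of_adjoint_eq_graph {T L : H →ₗ.[𝕜] H} (hL : T.graph.adjoint = L.graph) :
    Dense (T.domain : Set H) := by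
  rw [Submodule.dense_iff_topologicalClosure_eq_top, Submodule.topologicalClosure_eq_top_iff,
    Submodule.eq_bot_iff]
  intro g hg
  have h0 : ((0 : H), g) ∈ L.graph := by
    rw [← hL, Submodule.mem_adjoint_iff]
    intro a b hab
    have horth : inner 𝕜 a g = 0 := hg a (LinearPMap.mem_domain_of_mem_graph hab)
    rw [horth, inner_zero_right, sub_zero]
  exact LinearPMap.graph_fst_eq_zero_snd L h0 rfl

theorem essentiallySelfAdjoint_of_topologicalClosure_eq {T L : L2 →ₗ.[ℂ] L2}
    (hL : T.graph.adjoint = L.graph) (hcl : T.graph.topologicalClosure = L.graph) :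
    EssentiallySelfAdjoint T ∧ T.adjoint = L ∧ L = L.adjoint := by
  have hdense := dense_domain_of_adjoint_eq_graph hL
  have hclosable : T.IsClosable := ⟨L, hcl⟩
  have hTL : T ≤ L := LinearPMap.le_of_le_graph (hcl ▸ T.graph.le_topologicalClosure)
  have hclosure : T.closure = L := LinearPMap.eq_of_eq_graph
    (hclosable.graph_closure_eq_closure_graph.symm.trans hcl)
  have hadj : T.adjoint = L := LinearPMap.eq_of_eq_graph
    ((LinearPMap.adjoint_graph_eq_graph_adjoint hdense).trans hL)
  have hself : L = L.adjoint := LinearPMap.eq_of_eq_graph <| by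
    rw [LinearPMap.adjoint_graph_eq_graph_adjoint (hdense.mono hTL.1), ← hcl,
      adjoint_topologicalClosure, hL, hcl]
  refine ⟨⟨hdense, fun x y => ?_, hclosable, ?_⟩, hadj, hself⟩
  · have hTx : T x = T.adjoint ⟨x, hadj ▸ hTL.1 x.2⟩ := (hadj ▸ hTL).2 rfl
    rw [hTx]
    exact LinearPMap.adjoint_isFormalAdjoint hdense _ y
  · rw [hclosure, LinearPMap.isSelfAdjoint_def, ← hself]

end LinearRelation

section Primitive

open scoped ComplexConjugate NNReal

theorem absolutelyContinuousOnInterval_lipschitzOnWith_comp {X Y : Type*} [PseudoMetricSpace X]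
    [PseudoMetricSpace Y] {f : ℝ → X} {k : X → Y} {K : ℝ≥0} {s : Set X} {a b : ℝ}
    (hk : LipschitzOnWith K k s) (hf : AbsolutelyContinuousOnInterval f a b)
    (hs : MapsTo f (uIcc a b) s) : AbsolutelyContinuousOnInterval (fun x => k (f x)) a b := by
  refine squeeze_zero' (Eventually.of_forall fun E => Finset.sum_nonneg fun _ _ => dist_nonneg) ?_
    (by simpa only [mul_zero] using Tendsto.const_mul (K : ℝ) hf)
  filter_upwards [mem_inf_of_right (mem_principal_self _)] with E hE
  rw [Finset.mul_sum]
  exact Finset.sum_le_sum fun i hi => hk.dist_le_mul _ (hs (hE.1 i hi).1) _ (hs (hE.1 i hi).2)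

theorem absolutelyContinuousOnInterval_lipschitzWith_comp {X Y : Type*} [PseudoMetricSpace X]
    [PseudoMetricSpace Y] {f : ℝ → X} {k : X → Y} {K : ℝ≥0} {a b : ℝ} (hk : LipschitzWith K k)
    (hf : AbsolutelyContinuousOnInterval f a b) :
    AbsolutelyContinuousOnInterval (fun x => k (f x)) a b :=
  absolutelyContinuousOnInterval_lipschitzOnWith_comp (hk.lipschitzOnWith (s := univ)) hf
    (mapsTo_univ _ _)

theorem absolutelyContinuousOnInterval_contDiff_comp {f k : ℝ → ℝ} {a b : ℝ} (hk : ContDiff ℝ 1 k)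
    (hf : AbsolutelyContinuousOnInterval f a b) :
    AbsolutelyContinuousOnInterval (fun x => k (f x)) a b := by
  obtain ⟨C, hC⟩ := hf.exists_bound
  obtain ⟨K, hK⟩ := (hk.contDiffOn (s := Icc (-C) C)).exists_lipschitzOnWith one_ne_zero
    (convex_Icc _ _) isCompact_Icc
  exact absolutelyContinuousOnInterval_lipschitzOnWith_comp hK hf fun x hx => abs_le.1 (hC x hx)

theorem locallyIntegrable_of_intervalIntegrable {E : Type*} [NormedAddCommGroup E] {f : ℝ → E}
    (hf : ∀ a b, IntervalIntegrable f volume a b) : LocallyIntegrable f volume := fun x =>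
  ⟨Ioc (x - 1) (x + 1), Ioc_mem_nhds (by linarith) (by linarith), (hf _ _).1⟩

theorem intervalIntegrable_of_locallyIntegrable {E : Type*} [NormedAddCommGroup E] {f : ℝ → E}
    (hf : LocallyIntegrable f volume) (a b : ℝ) : IntervalIntegrable f volume a b :=
  (hf.integrableOn_isCompact isCompact_uIcc).intervalIntegrable

theorem acLoc_integral {U : ℝ → ℂ} (hU : LocallyIntegrable U volume) (c : ℂ) (x₀ : ℝ) :
    ACLoc fun x => c + ∫ t in x₀..x, U t := by
  intro a b
  have hUi := intervalIntegrable_of_locallyIntegrable hU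
  have hre : IntervalIntegrable (fun x => (U x).re) volume a b := ⟨(hUi a b).1.re, (hUi a b).2.re⟩
  have him : IntervalIntegrable (fun x => (U x).im) volume a b := ⟨(hUi a b).1.im, (hUi a b).2.im⟩
  have hac {φ : ℝ → ℝ} (hφ : IntervalIntegrable φ volume a b) :
      AbsolutelyContinuousOnInterval (fun x => ((∫ t in a..x, φ t : ℝ) : ℂ)) a b :=
    absolutelyContinuousOnInterval_lipschitzWith_comp Complex.isometry_ofReal.lipschitz
      (hφ.absolutelyContinuousOnInterval_intervalIntegral left_mem_uIcc)
  have hconst : AbsolutelyContinuousOnInterval (fun _ : ℝ => c + ∫ t in x₀..a, U t) a b :=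
    contDiff_const.contDiffOn.absolutelyContinuousOnInterval
  convert! hconst.add ((hac hre).add ((hac him).const_smul Complex.I)) using 1
  ext x
  have h1 : (∫ t in a..x, U t).re = ∫ t in a..x, (U t).re :=
    (Complex.reCLM.intervalIntegral_comp_comm (hUi a x)).symm
  have h2 : (∫ t in a..x, U t).im = ∫ t in a..x, (U t).im :=
    (Complex.imCLM.intervalIntegral_comp_comm (hUi a x)).symm
  rw [← intervalIntegral.integral_add_adjacent_intervals (hUi x₀ a) (hUi a x),
    ← Complex.re_add_im (∫ t in a..x, U t), h1, h2]
  simp only [Pi.add_apply, smul_eq_mul]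
  ring

/-- `u` is locally absolutely continuous and `U` is its derivative almost everywhere; this is how
a differential equation with `L¹_loc` coefficients is understood. -/
structure IsPrimitive (u U : ℝ → ℂ) : Prop where
  acLoc : ACLoc u
  hasDerivAt : ∀ᵐ x, HasDerivAt u (U x) x

variable {u v U V : ℝ → ℂ}

theorem ACLoc.isPrimitive (hu : ACLoc u) : IsPrimitive u (deriv u) :=
  ⟨hu, hu.ae_differentiableAt.mono fun _ h => h.hasDerivAt⟩

namespace IsPrimitive

theorem continuous (h : IsPrimitive u U) : Continuous u := h.acLoc.continuous

theorem deriv_ae (h : IsPrimitive u U) : deriv u =ᵐ[volume] U :=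
  h.hasDerivAt.mono fun _ h => h.deriv

theorem congr (h : IsPrimitive u U) (hUV : U =ᵐ[volume] V) : IsPrimitive u V :=
  ⟨h.acLoc, by filter_upwards [h.hasDerivAt, hUV] with x h1 h2; rwa [← h2]⟩

theorem add (hu : IsPrimitive u U) (hv : IsPrimitive v V) :
    IsPrimitive (fun x => u x + v x) (fun x => U x + V x) :=
  ⟨fun a b => (hu.acLoc a b).add (hv.acLoc a b), by
    filter_upwards [hu.hasDerivAt, hv.hasDerivAt] with x h1 h2 using h1.add h2⟩

theorem sub (hu : IsPrimitive u U) (hv : IsPrimitive v V) :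
    IsPrimitive (fun x => u x - v x) (fun x => U x - V x) :=
  ⟨fun a b => (hu.acLoc a b).sub (hv.acLoc a b), by
    filter_upwards [hu.hasDerivAt, hv.hasDerivAt] with x h1 h2 using h1.sub h2⟩

theorem mul (hu : IsPrimitive u U) (hv : IsPrimitive v V) :
    IsPrimitive (fun x => u x * v x) (fun x => U x * v x + u x * V x) :=
  ⟨fun a b => (hu.acLoc a b).smul (hv.acLoc a b), by
    filter_upwards [hu.hasDerivAt, hv.hasDerivAt] with x h1 h2 using h1.mul h2⟩

theorem const_mul (c : ℂ) (hu : IsPrimitive u U) :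
    IsPrimitive (fun x => c * u x) (fun x => c * U x) :=
  ⟨fun a b => (hu.acLoc a b).const_smul c, by
    filter_upwards [hu.hasDerivAt] with x h1 using h1.const_mul c⟩

theorem conjugate (hu : IsPrimitive u U) :
    IsPrimitive (fun x => conj (u x)) (fun x => conj (U x)) :=
  ⟨fun a b => absolutelyContinuousOnInterval_lipschitzWith_comp Complex.isometry_conj.lipschitz
    (hu.acLoc a b), by filter_upwards [hu.hasDerivAt] with x h1 using h1.star⟩

theorem ofReal_of_contDiff {φ : ℝ → ℝ} (hφ : ContDiff ℝ 1 φ) :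
    IsPrimitive (fun x => (φ x : ℂ)) (fun x => ((deriv φ x : ℝ) : ℂ)) :=
  ⟨fun _ _ => absolutelyContinuousOnInterval_lipschitzWith_comp Complex.isometry_ofReal.lipschitz
    hφ.contDiffOn.absolutelyContinuousOnInterval, Eventually.of_forall fun _ =>
      (hφ.differentiable one_ne_zero).differentiableAt.hasDerivAt.ofReal_comp⟩

theorem intervalIntegrable_and_integral_eq (h : IsPrimitive u U) (a b : ℝ) :
    IntervalIntegrable U volume a b ∧ ∫ x in a..b, U x = u b - u a := by
  have hre : AbsolutelyContinuousOnInterval (fun x => (u x).re) a b :=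
    absolutelyContinuousOnInterval_lipschitzWith_comp (RCLike.lipschitzWith_re (K := ℂ))
      (h.acLoc a b)
  have him : AbsolutelyContinuousOnInterval (fun x => (u x).im) a b :=
    absolutelyContinuousOnInterval_lipschitzWith_comp (RCLike.lipschitzWith_im (K := ℂ))
      (h.acLoc a b)
  have dre : deriv (fun x => (u x).re) =ᵐ[volume] fun x => (U x).re := h.hasDerivAt.mono fun x hx =>
    (Complex.reCLM.hasFDerivAt.comp_hasDerivAt x hx).deriv
  have dim : deriv (fun x => (u x).im) =ᵐ[volume] fun x => (U x).im := h.hasDerivAt.mono fun x hx =>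
    (Complex.imCLM.hasFDerivAt.comp_hasDerivAt x hx).deriv
  have ire := hre.intervalIntegrable_deriv.congr_ae (ae_restrict_of_ae dre)
  have iim := him.intervalIntegrable_deriv.congr_ae (ae_restrict_of_ae dim)
  have ire' : IntervalIntegrable (fun x => ((U x).re : ℂ)) volume a b :=
    ⟨ire.1.ofReal, ire.2.ofReal⟩
  have iim' : IntervalIntegrable (fun x => ((U x).im : ℂ) * Complex.I) volume a b :=
    ⟨iim.1.ofReal.mul_const _, iim.2.ofReal.mul_const _⟩
  have hU : U = fun x => ((U x).re : ℂ) + ((U x).im : ℂ) * Complex.I :=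
    funext fun x => (Complex.re_add_im _).symm
  rw [hU]
  refine ⟨ire'.add iim', ?_⟩
  rw [intervalIntegral.integral_add ire' iim', intervalIntegral.integral_mul_const,
    intervalIntegral.integral_ofReal, intervalIntegral.integral_ofReal,
    ← intervalIntegral.integral_congr_ae (dre.mono fun x hx _ => hx),
    ← intervalIntegral.integral_congr_ae (dim.mono fun x hx _ => hx),
    hre.integral_deriv_eq_sub, him.integral_deriv_eq_sub]
  apply Complex.ext <;> simp

theorem integral_eq (h : IsPrimitive u U) (a b : ℝ) : ∫ x in a..b, U x = u b - u a :=
  (h.intervalIntegrable_and_integral_eq a b).2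

theorem locallyIntegrable (h : IsPrimitive u U) : LocallyIntegrable U volume :=
  locallyIntegrable_of_intervalIntegrable fun a b => (h.intervalIntegrable_and_integral_eq a b).1

theorem of_integral (hU : LocallyIntegrable U volume) {c : ℂ} {x₀ : ℝ}
    (hu : ∀ x, u x = c + ∫ t in x₀..x, U t) : IsPrimitive u U := by
  rw [funext hu]
  refine ⟨acLoc_integral hU c x₀, ?_⟩
  filter_upwards [_root_.LocallyIntegrable.ae_hasDerivAt_integral hU] with x hx
  exact (hx x₀).const_add c

theorem indicator_Ioc (h : IsPrimitive u U) {a b : ℝ} (hab : a ≤ b) (ha : u a = 0) (hb : u b = 0) :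
    IsPrimitive ((Ioc a b).indicator u) ((Ioc a b).indicator U) := by
  refine of_integral (h.locallyIntegrable.indicator measurableSet_Ioc) (c := 0) (x₀ := a)
    fun x => ?_
  rw [zero_add]
  rcases le_or_gt x a with hxa | hax
  · rw [indicator_of_notMem (fun hx => hx.1.not_ge hxa), intervalIntegral.integral_of_ge hxa,
      setIntegral_indicator measurableSet_Ioc]
    have hempty : Ioc x a ∩ Ioc a b = ∅ := by
      ext t; simp only [mem_inter_iff, mem_Ioc, mem_empty_iff_false]; grind
    rw [hempty, setIntegral_empty, neg_zero]
  · have hclamp : ∫ t in a..x, (Ioc a b).indicator U t = u (min x b) - u a := by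
      rw [← h.integral_eq, intervalIntegral.integral_of_le hax.le,
        intervalIntegral.integral_of_le (le_min hax.le hab),
        setIntegral_indicator measurableSet_Ioc, Ioc_inter_Ioc, max_self]
    rw [hclamp, ha, sub_zero]
    rcases le_or_gt x b with hxb | hbx
    · rw [indicator_of_mem (mem_Ioc.2 ⟨hax, hxb⟩), min_eq_left hxb]
    · rw [indicator_of_notMem (fun hx => hx.2.not_gt hbx), min_eq_right hbx.le, hb]

theorem integral_eq_zero_of_hasCompactSupport (h : IsPrimitive u U) (hu : HasCompactSupport u) :
    ∫ x, U x = 0 := by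
  obtain ⟨R, -, hsub⟩ := hu.isCompact.isBounded.subset_ball_lt 0 0
  rw [Real.ball_eq_Ioo, zero_sub, zero_add] at hsub
  have hzero (x : ℝ) (hx : x ∉ Ioo (-R) R) : u x = 0 := image_eq_zero_of_notMem_tsupport
    fun hx' => hx (hsub hx')
  rw [← integral_congr_ae h.deriv_ae, ← intervalIntegral.integral_eq_integral_of_support_subset
    ((support_deriv_subset.trans hsub).trans Ioo_subset_Ioc_self),
    h.acLoc.isPrimitive.integral_eq, hzero _ (by simp), hzero _ (by simp), sub_zero]

end IsPrimitive

theorem isPrimitive_iff : IsPrimitive u U ↔ ACLoc u ∧ deriv u =ᵐ[volume] U :=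
  ⟨fun h => ⟨h.acLoc, h.deriv_ae⟩, fun h => h.1.isPrimitive.congr h.2⟩

end Primitive

section Caratheodory

variable {k : ℝ → ℝ}

theorem integral_mul_exp_integral (hk : LocallyIntegrable k volume) (c a b : ℝ) :
    ∫ t in a..b, Real.exp (c * ∫ s in a..t, k s) * (c * k t) =
      Real.exp (c * ∫ s in a..b, k s) - 1 := by
  have hki := intervalIntegrable_of_locallyIntegrable hk a b
  have hac := absolutelyContinuousOnInterval_contDiff_comp Real.contDiff_exp
    ((hki.absolutelyContinuousOnInterval_intervalIntegral left_mem_uIcc).const_mul c)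
  have hderiv : deriv (fun t => Real.exp (c * ∫ s in a..t, k s)) =ᵐ[volume]
      fun t => Real.exp (c * ∫ s in a..t, k s) * (c * k t) := by
    filter_upwards [_root_.LocallyIntegrable.ae_hasDerivAt_integral hk] with t ht
    exact ((ht a).const_mul c).exp.deriv
  rw [← intervalIntegral.integral_congr_ae (hderiv.mono fun t ht _ => ht),
    hac.integral_deriv_eq_sub, intervalIntegral.integral_same, mul_zero, Real.exp_zero]

/-- The weight `exp (2 |∫ k|)`; in the supremum norm with this weight the Picard iteration is a
contraction on the whole line. -/
def picardWeight (k : ℝ → ℝ) (x₀ x : ℝ) : ℝ := Real.exp (2 * |∫ t in x₀..x, k t|)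

theorem one_le_picardWeight (k : ℝ → ℝ) (x₀ x : ℝ) : 1 ≤ picardWeight k x₀ x :=
  Real.one_le_exp (by positivity)

theorem continuous_picardWeight (hk : LocallyIntegrable k volume) (x₀ : ℝ) :
    Continuous (picardWeight k x₀) :=
  Real.continuous_exp.comp (continuous_const.mul
    (intervalIntegral.continuous_primitive (intervalIntegrable_of_locallyIntegrable hk) x₀).abs)

theorem integral_mul_picardWeight_le (hk : LocallyIntegrable k volume) (hk0 : ∀ t, 0 ≤ k t)
    (x₀ x : ℝ) : ∫ t in uIoc x₀ x, k t * picardWeight k x₀ t ≤ picardWeight k x₀ x / 2 := by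
  rcases le_total x₀ x with hx | hx
  · have habs (t : ℝ) (ht : x₀ ≤ t) : |∫ s in x₀..t, k s| = ∫ s in x₀..t, k s :=
      abs_of_nonneg (intervalIntegral.integral_nonneg ht fun s _ => hk0 s)
    have hint : ∫ t in uIoc x₀ x, k t * picardWeight k x₀ t =
        (∫ t in x₀..x, Real.exp (2 * ∫ s in x₀..t, k s) * (2 * k t)) / 2 := by
      rw [uIoc_of_le hx, intervalIntegral.integral_of_le hx, ← integral_div]
      refine setIntegral_congr_fun measurableSet_Ioc fun t ht => ?_
      simp only [picardWeight, habs t ht.1.le]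
      ring
    rw [hint, integral_mul_exp_integral hk, picardWeight, habs x hx]
    linarith
  · have habs (t : ℝ) (ht : t ≤ x₀) : |∫ s in x₀..t, k s| = -∫ s in x₀..t, k s := by
      rw [intervalIntegral.integral_symm t x₀, neg_neg, abs_neg,
        abs_of_nonneg (intervalIntegral.integral_nonneg ht fun s _ => hk0 s)]
    have hint : ∫ t in uIoc x₀ x, k t * picardWeight k x₀ t =
        (∫ t in x₀..x, Real.exp (-2 * ∫ s in x₀..t, k s) * (-2 * k t)) / 2 := by
      rw [uIoc_of_ge hx, intervalIntegral.integral_of_ge hx, ← integral_neg, ← integral_div]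
      refine setIntegral_congr_fun measurableSet_Ioc fun t ht => ?_
      simp only [picardWeight, habs t ht.2, neg_mul, mul_neg, neg_neg]
      ring
    rw [hint, integral_mul_exp_integral hk, picardWeight, habs x hx, neg_mul, mul_neg]
    linarith

theorem norm_integral_le_of_norm_le_mul {E : Type*} [NormedAddCommGroup E] [NormedSpace ℝ E]
    {G : ℝ → E} {C D x₀ x : ℝ} (hk : LocallyIntegrable k volume)
    (hkD : ∫ t in uIoc x₀ x, k t ≤ D) (hC : 0 ≤ C) (hG : ∀ t, ‖G t‖ ≤ C * k t) :
    ‖∫ t in x₀..x, G t‖ ≤ C * D :=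
  calc ‖∫ t in x₀..x, G t‖ ≤ ∫ t in uIoc x₀ x, ‖G t‖ :=
        intervalIntegral.norm_integral_le_integral_norm_uIoc
    _ ≤ ∫ t in uIoc x₀ x, C * k t :=
        integral_mono_of_nonneg (Eventually.of_forall fun _ => norm_nonneg _)
          ((intervalIntegrable_iff.1 (intervalIntegrable_of_locallyIntegrable hk x₀ x)).const_mul C)
          (Eventually.of_forall hG)
    _ ≤ C * D := by
        rw [integral_const_mul]
        exact mul_le_mul_of_nonneg_left hkD hC

theorem norm_le_mul_of_lipschitz {E : Type*} [NormedAddCommGroup E] {F : ℝ → E → E}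
    (hlip : ∀ t x y, ‖F t x - F t y‖ ≤ k t * ‖x - y‖) (h0 : ∀ t, ‖F t 0‖ ≤ k t) (t : ℝ) (x : E) :
    ‖F t x‖ ≤ (‖x‖ + 1) * k t :=
  calc ‖F t x‖ ≤ ‖F t x - F t 0‖ + ‖F t 0‖ := norm_le_norm_sub_add _ _
    _ ≤ k t * ‖x‖ + k t := add_le_add (by simpa only [sub_zero] using hlip t x 0) (h0 t)
    _ = (‖x‖ + 1) * k t := by ring

theorem locallyIntegrable_comp_of_lipschitz {E : Type*} [NormedAddCommGroup E] {F : ℝ → E → E}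
    (hk : LocallyIntegrable k volume)
    (hmeas : ∀ y : ℝ → E, Continuous y → AEStronglyMeasurable (fun t => F t (y t)) volume)
    (hlip : ∀ t x y, ‖F t x - F t y‖ ≤ k t * ‖x - y‖) (h0 : ∀ t, ‖F t 0‖ ≤ k t) {y : ℝ → E}
    (hy : Continuous y) : LocallyIntegrable (fun t => F t (y t)) volume := by
  have hdom : LocallyIntegrable (fun t => (‖y t‖ + 1) • k t) volume :=
    LocallyIntegrable.continuous_smul (hy.norm.add continuous_const) hk
  exact hdom.mono (hmeas y hy) (Eventually.of_forall fun t =>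
    (norm_le_mul_of_lipschitz hlip h0 t (y t)).trans (Real.le_norm_self _))

variable {E : Type*} [NormedAddCommGroup E] [NormedSpace ℝ E] [CompleteSpace E] {F : ℝ → E → E}

open scoped BoundedContinuousFunction in
theorem exists_boundedContinuousFunction_eq_inv_smul {w : ℝ → ℝ} {x₀ : ℝ} (hwc : Continuous w)
    (hw1 : ∀ x, 1 ≤ w x) (hk : LocallyIntegrable k volume)
    (hkw : ∀ x, ∫ t in uIoc x₀ x, k t ≤ w x / 2)
    (hmeas : ∀ y : ℝ → E, Continuous y → AEStronglyMeasurable (fun t => F t (y t)) volume)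
    (hlip : ∀ t x y, ‖F t x - F t y‖ ≤ k t * ‖x - y‖) (h0 : ∀ t, ‖F t 0‖ ≤ k t) (y₀ : E) :
    ∃ m : ℝ →ᵇ E, ∀ x, m x = (w x)⁻¹ • (y₀ + ∫ t in x₀..x, F t (m t)) := by
  have hk0 (t : ℝ) : 0 ≤ k t := (norm_nonneg _).trans (h0 t)
  have hwpos (t : ℝ) : 0 < w t := one_pos.trans_le (hw1 t)
  have hint (m : ℝ →ᵇ E) (a b : ℝ) : IntervalIntegrable (fun t => F t (m t)) volume a b :=
    intervalIntegrable_of_locallyIntegrable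
      (locallyIntegrable_comp_of_lipschitz hk hmeas hlip h0 m.continuous) a b
  have hinv (x : ℝ) (y : E) : ‖(w x)⁻¹ • y‖ = ‖y‖ / w x := by
    rw [norm_smul, norm_inv, Real.norm_of_nonneg (hwpos x).le, inv_mul_eq_div]
  let T (m : ℝ →ᵇ E) : ℝ →ᵇ E := BoundedContinuousFunction.ofNormedAddCommGroup
    (fun x => (w x)⁻¹ • (y₀ + ∫ t in x₀..x, F t (m t)))
    ((hwc.inv₀ fun x => (hwpos x).ne').smul
      (continuous_const.add (intervalIntegral.continuous_primitive (hint m) x₀)))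
    (‖y₀‖ + (‖m‖ + 1) / 2) fun x => by
      have hgrowth (t : ℝ) : ‖F t (m t)‖ ≤ (‖m‖ + 1) * k t :=
        (norm_le_mul_of_lipschitz hlip h0 t (m t)).trans
          (mul_le_mul_of_nonneg_right (by gcongr; exact m.norm_coe_le_norm t) (hk0 t))
      rw [hinv, div_le_iff₀ (hwpos x)]
      have := norm_integral_le_of_norm_le_mul hk (hkw x) (by positivity) hgrowth
      have := norm_add_le y₀ (∫ t in x₀..x, F t (m t))
      have := le_mul_of_one_le_right (norm_nonneg y₀) (hw1 x)
      linarith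
  have hT : ContractingWith (1 / 2) T := by
    refine ⟨by norm_num, LipschitzWith.of_dist_le_mul fun m m' =>
      (BoundedContinuousFunction.dist_le (by positivity)).2 fun x => ?_⟩
    have hdiff (t : ℝ) : ‖F t (m t) - F t (m' t)‖ ≤ dist m m' * k t :=
      (hlip t _ _).trans (by
        rw [mul_comm, ← dist_eq_norm]
        exact mul_le_mul_of_nonneg_right (m.dist_coe_le_dist t) (hk0 t))
    have hsub : T m x - T m' x = (w x)⁻¹ • ∫ t in x₀..x, (F t (m t) - F t (m' t)) := by
      rw [intervalIntegral.integral_sub (hint m _ _) (hint m' _ _)]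
      simp only [T, BoundedContinuousFunction.coe_ofNormedAddCommGroup, ← smul_sub,
        add_sub_add_left_eq_sub]
    rw [dist_eq_norm, hsub, hinv, div_le_iff₀ (hwpos x)]
    refine (norm_integral_le_of_norm_le_mul hk (hkw x) dist_nonneg hdiff).trans_eq ?_
    simp only [NNReal.coe_div, NNReal.coe_one, NNReal.coe_ofNat]
    ring
  exact ⟨_, fun x => (DFunLike.congr_fun hT.fixedPoint_isFixedPt x).symm⟩

theorem exists_eq_add_integral_of_lipschitz (hk : LocallyIntegrable k volume)
    (hmeas : ∀ y : ℝ → E, Continuous y → AEStronglyMeasurable (fun t => F t (y t)) volume)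
    (hlip : ∀ t x y, ‖F t x - F t y‖ ≤ k t * ‖x - y‖) (h0 : ∀ t, ‖F t 0‖ ≤ k t) (x₀ : ℝ) (y₀ : E) :
    ∃ y : ℝ → E, Continuous y ∧ ∀ x, y x = y₀ + ∫ t in x₀..x, F t (y t) := by
  have hk0 (t : ℝ) : 0 ≤ k t := (norm_nonneg _).trans (h0 t)
  set w := picardWeight k x₀
  have hwc : Continuous w := continuous_picardWeight hk x₀
  have hw1 : ∀ t, 1 ≤ w t := one_le_picardWeight k x₀
  have hwpos (t : ℝ) : 0 < w t := one_pos.trans_le (hw1 t)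
  have hkw : LocallyIntegrable (fun t => k t * w t) volume := by
    simpa only [smul_eq_mul, mul_comm] using LocallyIntegrable.continuous_smul hwc hk
  obtain ⟨m, hm⟩ := exists_boundedContinuousFunction_eq_inv_smul (F := fun t x => F t (w t • x))
    hwc hw1 hkw (integral_mul_picardWeight_le hk hk0 x₀) (fun y hy => hmeas _ (hwc.smul hy))
    (fun t x y => by
      simpa only [← smul_sub, norm_smul, Real.norm_of_nonneg (hwpos t).le, mul_assoc]
        using hlip t (w t • x) (w t • y))
    (fun t => by
      simpa only [smul_zero] using (h0 t).trans (le_mul_of_one_le_right (hk0 t) (hw1 t))) y₀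
  refine ⟨fun x => w x • m x, hwc.smul m.continuous, fun x => ?_⟩
  change w x • m x = _
  rw [hm x, smul_inv_smul₀ (hwpos x).ne']

end Caratheodory

section FirstOrderSystem

open scoped ComplexConjugate

/-- The pair `(u, v)` solves the first order system `u' = α v + β u`, `v' = -β̄ v - γ u - g`. For
`α = 1 / p`, `β = (Q + i r) / p`, `γ = (Q² + r²) / p - s` this is the equation `l[u] = g`, with `v`
the first quasi-derivative of `u`. -/
structure IsSolution (α : ℝ → ℝ) (β : ℝ → ℂ) (γ : ℝ → ℝ) (g u v : ℝ → ℂ) : Prop where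
  fst : IsPrimitive u fun x => (α x : ℂ) * v x + β x * u x
  snd : IsPrimitive v fun x => -(conj (β x)) * v x - (γ x : ℂ) * u x - g x

variable {α γ : ℝ → ℝ} {β g h u v w z : ℝ → ℂ}

namespace IsSolution

theorem green (huv : IsSolution α β γ g u v) (hwz : IsSolution α β γ h w z) :
    IsPrimitive (fun x => u x * conj (z x) - v x * conj (w x))
      (fun x => g x * conj (w x) - u x * conj (h x)) := by
  refine ((huv.fst.mul hwz.snd.conjugate).sub (huv.snd.mul hwz.fst.conjugate)).congr
    (Eventually.of_forall fun x => ?_)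
  simp only [map_sub, map_add, map_mul, map_neg, Complex.conj_conj, Complex.conj_ofReal]
  ring

theorem mul_conj_eq_of_orthogonal (huv : IsSolution α β γ g u v) (hwz : IsSolution α β γ 0 w z)
    {a b : ℝ} (hua : u a = 0) (hva : v a = 0) (horth : ∫ x in a..b, g x * conj (w x) = 0) :
    u b * conj (z b) = v b * conj (w b) := by
  have h := (huv.green hwz).integral_eq a b
  simp only [Pi.zero_apply, map_zero, mul_zero, sub_zero, hua, hva, zero_mul, horth] at h
  exact sub_eq_zero.1 h.symm

theorem sub (huv : IsSolution α β γ g u v) (hwz : IsSolution α β γ h w z) :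
    IsSolution α β γ (fun x => g x - h x) (fun x => u x - w x) (fun x => v x - z x) where
  fst := (huv.fst.sub hwz.fst).congr (Eventually.of_forall fun x => by ring)
  snd := (huv.snd.sub hwz.snd).congr (Eventually.of_forall fun x => by ring)

theorem add_const_mul (huv : IsSolution α β γ g u v) (c : ℂ) (hwz : IsSolution α β γ 0 w z) :
    IsSolution α β γ g (fun x => u x + c * w x) (fun x => v x + c * z x) where
  fst := (huv.fst.add (hwz.fst.const_mul c)).congr (Eventually.of_forall fun x => by ring)
  snd := (huv.snd.add (hwz.snd.const_mul c)).congr (Eventually.of_forall fun x => by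
    simp only [Pi.zero_apply]; ring)

theorem congr_rhs (huv : IsSolution α β γ g u v) (hgh : g =ᵐ[volume] h) :
    IsSolution α β γ h u v where
  fst := huv.fst
  snd := huv.snd.congr (hgh.mono fun x hx => by simp only [hx])

theorem indicator_Ioc (huv : IsSolution α β γ g u v) {a b : ℝ} (hab : a ≤ b) (hua : u a = 0)
    (hva : v a = 0) (hub : u b = 0) (hvb : v b = 0) :
    IsSolution α β γ ((Ioc a b).indicator g) ((Ioc a b).indicator u) ((Ioc a b).indicator v) where
  fst := (huv.fst.indicator_Ioc hab hua hub).congr <| Eventually.of_forall fun x => by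
    by_cases hx : x ∈ Ioc a b <;> simp [hx]
  snd := (huv.snd.indicator_Ioc hab hva hvb).congr <| Eventually.of_forall fun x => by
    by_cases hx : x ∈ Ioc a b <;> simp [hx]

theorem snd_eq_zero_of_fst_eq_zero (hα : ∀ᵐ x, α x ≠ 0) (huv : IsSolution α β γ g u v) {s : Set ℝ}
    (hs : IsOpen s) (hu : ∀ x ∈ s, u x = 0) : ∀ x ∈ s, v x = 0 := by
  have hae : v =ᵐ[volume.restrict s] 0 := by
    rw [Filter.EventuallyEq, ae_restrict_iff' hs.measurableSet]
    filter_upwards [hα, huv.fst.hasDerivAt] with x hαx hx hxs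
    have hux : u =ᶠ[nhds x] fun _ => 0 := eventually_of_mem (hs.mem_nhds hxs) hu
    have h0 : (α x : ℂ) * v x + β x * u x = 0 :=
      hx.unique ((hasDerivAt_const x (0 : ℂ)).congr_of_eventuallyEq hux)
    rw [hu x hxs, mul_zero, add_zero] at h0
    exact (mul_eq_zero.1 h0).resolve_left (Complex.ofReal_ne_zero.2 hαx)
  exact Measure.eqOn_open_of_ae_eq hae hs huv.snd.continuous.continuousOn continuousOn_const

end IsSolution

/-- The right-hand side `(u, v) ↦ (α v + β u, -β̄ v - γ u - g)` of the first order system. -/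
def systemField (α : ℝ → ℝ) (β : ℝ → ℂ) (γ : ℝ → ℝ) (g : ℝ → ℂ) (t : ℝ) (y : ℂ × ℂ) : ℂ × ℂ :=
  ((α t : ℂ) * y.2 + β t * y.1, -(conj (β t)) * y.2 - (γ t : ℂ) * y.1 - g t)

theorem norm_systemField_sub_le (α : ℝ → ℝ) (β : ℝ → ℂ) (γ : ℝ → ℝ) (g : ℝ → ℂ) (t : ℝ)
    (x y : ℂ × ℂ) :
    ‖systemField α β γ g t x - systemField α β γ g t y‖ ≤ (‖α t‖ + ‖β t‖ + ‖γ t‖) * ‖x - y‖ := by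
  have hmul (a b : ℂ) : ‖a * (x - y).2 + b * (x - y).1‖ ≤ (‖a‖ + ‖b‖) * ‖x - y‖ :=
    calc _ ≤ ‖a‖ * ‖(x - y).2‖ + ‖b‖ * ‖(x - y).1‖ :=
          (norm_add_le _ _).trans_eq (by rw [norm_mul, norm_mul])
      _ ≤ ‖a‖ * ‖x - y‖ + ‖b‖ * ‖x - y‖ := by
          gcongr
          exacts [norm_snd_le _, norm_fst_le _]
      _ = (‖a‖ + ‖b‖) * ‖x - y‖ := by ring
  have hsub : systemField α β γ g t x - systemField α β γ g t y =
      ((α t : ℂ) * (x - y).2 + β t * (x - y).1,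
        -(conj (β t)) * (x - y).2 + -(γ t : ℂ) * (x - y).1) :=
    Prod.ext (by simp only [systemField, Prod.fst_sub, Prod.snd_sub]; ring)
      (by simp only [systemField, Prod.fst_sub, Prod.snd_sub]; ring)
  rw [hsub]
  refine max_le ((hmul _ _).trans (mul_le_mul_of_nonneg_right ?_ (norm_nonneg _)))
    ((hmul _ _).trans (mul_le_mul_of_nonneg_right ?_ (norm_nonneg _))) <;>
  · simp only [Complex.norm_real, norm_neg, RCLike.norm_conj]
    linarith [norm_nonneg (α t), norm_nonneg (γ t)]

theorem norm_systemField_zero (α : ℝ → ℝ) (β : ℝ → ℂ) (γ : ℝ → ℝ) (g : ℝ → ℂ) (t : ℝ) :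
    ‖systemField α β γ g t 0‖ = ‖g t‖ := by
  simp [systemField]

theorem locallyIntegrable_norm {E : Type*} [NormedAddCommGroup E] {f : ℝ → E}
    (hf : LocallyIntegrable f volume) : LocallyIntegrable (fun x => ‖f x‖) volume :=
  fun x => (hf x).norm

variable (hα : LocallyIntegrable α volume) (hβ : LocallyIntegrable β volume)
  (hγ : LocallyIntegrable γ volume)

include hα hβ hγ

theorem aestronglyMeasurable_systemField (hg : LocallyIntegrable g volume) {y : ℝ → ℂ × ℂ}
    (hy : Continuous y) :
    AEStronglyMeasurable (fun t => systemField α β γ g t (y t)) volume := by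
  have hα' := Complex.continuous_ofReal.comp_aestronglyMeasurable hα.aestronglyMeasurable
  have hγ' := Complex.continuous_ofReal.comp_aestronglyMeasurable hγ.aestronglyMeasurable
  have hβ' := hβ.aestronglyMeasurable
  have hβc := Complex.continuous_conj.comp_aestronglyMeasurable hβ'
  have hy₁ := hy.fst.aestronglyMeasurable (μ := volume)
  have hy₂ := hy.snd.aestronglyMeasurable (μ := volume)
  exact ((hα'.mul hy₂).add (hβ'.mul hy₁)).prodMk
    (((hβc.neg.mul hy₂).sub (hγ'.mul hy₁)).sub hg.aestronglyMeasurable)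

theorem exists_isSolution (hg : LocallyIntegrable g volume) (x₀ : ℝ) (c d : ℂ) :
    ∃ u v, IsSolution α β γ g u v ∧ u x₀ = c ∧ v x₀ = d := by
  set F := systemField α β γ g
  have hk : LocallyIntegrable (fun t => ‖α t‖ + ‖β t‖ + ‖γ t‖ + ‖g t‖) volume :=
    (((locallyIntegrable_norm hα).add (locallyIntegrable_norm hβ)).add
      (locallyIntegrable_norm hγ)).add (locallyIntegrable_norm hg)
  have hmeas (y : ℝ → ℂ × ℂ) (hy : Continuous y) :
      AEStronglyMeasurable (fun t => F t (y t)) volume :=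
    aestronglyMeasurable_systemField hα hβ hγ hg hy
  have hlip (t : ℝ) (x y : ℂ × ℂ) :
      ‖F t x - F t y‖ ≤ (‖α t‖ + ‖β t‖ + ‖γ t‖ + ‖g t‖) * ‖x - y‖ :=
    (norm_systemField_sub_le α β γ g t x y).trans
      (mul_le_mul_of_nonneg_right (le_add_of_nonneg_right (norm_nonneg _)) (norm_nonneg _))
  have h0 (t : ℝ) : ‖F t 0‖ ≤ ‖α t‖ + ‖β t‖ + ‖γ t‖ + ‖g t‖ :=
    (norm_systemField_zero α β γ g t).le.trans (le_add_of_nonneg_left (by positivity))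
  obtain ⟨y, hy, hyint⟩ := exists_eq_add_integral_of_lipschitz hk hmeas hlip h0 x₀ (c, d)
  have hF := locallyIntegrable_comp_of_lipschitz hk hmeas hlip h0 hy
  have hFi := intervalIntegrable_of_locallyIntegrable hF x₀
  have hfst (x : ℝ) : (y x).1 = c + ∫ t in x₀..x, (F t (y t)).1 := by
    rw [hyint x, Prod.fst_add]
    exact congrArg _ ((ContinuousLinearMap.fst ℝ ℂ ℂ).intervalIntegral_comp_comm (hFi x)).symm
  have hsnd (x : ℝ) : (y x).2 = d + ∫ t in x₀..x, (F t (y t)).2 := by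
    rw [hyint x, Prod.snd_add]
    exact congrArg _ ((ContinuousLinearMap.snd ℝ ℂ ℂ).intervalIntegral_comp_comm (hFi x)).symm
  refine ⟨fun x => (y x).1, fun x => (y x).2, ⟨.of_integral ?_ hfst, .of_integral ?_ hsnd⟩,
    (hfst x₀).trans (by simp), (hsnd x₀).trans (by simp)⟩
  · exact fun x => let ⟨s, hs, hi⟩ := hF x; ⟨s, hs, hi.fst⟩
  · exact fun x => let ⟨s, hs, hi⟩ := hF x; ⟨s, hs, hi.snd⟩

theorem IsSolution.eq_zero (huv : IsSolution α β γ 0 u v) {x₀ : ℝ} (hu : u x₀ = 0)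
    (hv : v x₀ = 0) (x : ℝ) : u x = 0 ∧ v x = 0 := by
  obtain ⟨w₁, z₁, hs₁, hw₁, hz₁⟩ := exists_isSolution hα hβ hγ locallyIntegrable_zero x 1 0
  obtain ⟨w₂, z₂, hs₂, hw₂, hz₂⟩ := exists_isSolution hα hβ hγ locallyIntegrable_zero x 0 1
  constructor
  · simpa [hw₂, hz₂] using huv.mul_conj_eq_of_orthogonal (b := x) hs₂ hu hv (by simp)
  · simpa [hw₁, hz₁] using (huv.mul_conj_eq_of_orthogonal (b := x) hs₁ hu hv (by simp)).symm

theorem IsSolution.fst_eq_of_ae_eq (hα₀ : ∀ᵐ x, α x ≠ 0) (huv : IsSolution α β γ g u v)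
    (hwz : IsSolution α β γ g w z) {s : Set ℝ} (hs : IsOpen s) (hne : s.Nonempty)
    (huw : u =ᵐ[volume.restrict s] w) : u = w := by
  have hdiff : IsSolution α β γ 0 (fun x => u x - w x) (fun x => v x - z x) :=
    (huv.sub hwz).congr_rhs (Eventually.of_forall fun x => sub_self _)
  have hzero : ∀ x ∈ s, u x - w x = 0 := fun x hx =>
    sub_eq_zero.2 (Measure.eqOn_open_of_ae_eq huw hs huv.fst.continuous.continuousOn
      hwz.fst.continuous.continuousOn hx)
  obtain ⟨x₀, hx₀⟩ := hne
  exact funext fun x => sub_eq_zero.1 (hdiff.eq_zero hα hβ hγ (hzero x₀ hx₀)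
    (hdiff.snd_eq_zero_of_fst_eq_zero hα₀ hs hzero x₀ hx₀) x).1

end FirstOrderSystem

section Regularity

open scoped ComplexConjugate

/-- The maximal relation of the first order system in `L²(ℝ)`: the class `f` is represented by the
first component of a solution with right-hand side `g`. -/
def IsL2Solution (α : ℝ → ℝ) (β : ℝ → ℂ) (γ : ℝ → ℝ) (f g : L2) : Prop :=
  ∃ u v, IsSolution α β γ g u v ∧ f =ᵐ[volume] u

/-- Weak solutions: `(f, g)` is orthogonal, in the sense of Green's formula, to all compactly
supported pairs of the maximal relation. -/
def IsWeakL2Solution (α : ℝ → ℝ) (β : ℝ → ℂ) (γ : ℝ → ℝ) (f g : L2) : Prop :=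
  ∀ F G : L2, IsL2Solution α β γ F G → F ∈ compactlySupported → inner ℂ G f = inner ℂ F g

theorem inner_eq_integral {f g : L2} {u w : ℝ → ℂ} (hf : f =ᵐ[volume] u) (hg : g =ᵐ[volume] w) :
    inner ℂ f g = ∫ x, w x * conj (u x) := by
  rw [L2.inner_def]
  refine integral_congr_ae ?_
  filter_upwards [hf, hg] with x h1 h2
  rw [h1, h2, RCLike.inner_apply]

theorem inner_indicator_Ioc_eq_integral {f g : L2} {u : ℝ → ℂ} {a b : ℝ} (hab : a ≤ b)
    (hf : f =ᵐ[volume] (Ioc a b).indicator u) :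
    inner ℂ f g = ∫ x in a..b, g x * conj (u x) := by
  rw [inner_eq_integral hf (EventuallyEq.refl _ _), intervalIntegral.integral_of_le hab,
    ← integral_indicator measurableSet_Ioc]
  refine integral_congr_ae (Eventually.of_forall fun x => ?_)
  by_cases hx : x ∈ Ioc a b <;> simp [hx]

theorem memLp_indicator_Ioc {y : ℝ → ℂ} (hy : Continuous y) (a b : ℝ) :
    MemLp ((Ioc a b).indicator y) 2 volume := by
  rw [memLp_indicator_iff_restrict measurableSet_Ioc]
  obtain ⟨C, hC⟩ := isCompact_Icc.exists_bound_of_continuousOn (s := Icc a b) hy.continuousOn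
  refine MemLp.of_bound hy.aestronglyMeasurable C ?_
  filter_upwards [ae_restrict_mem measurableSet_Ioc] with x hx using hC x (Ioc_subset_Icc_self hx)

theorem mem_compactlySupported_of_ae_eq_indicator_Ioc {f : L2} {u : ℝ → ℂ} {a b : ℝ}
    (hf : f =ᵐ[volume] (Ioc a b).indicator u) : f ∈ compactlySupported :=
  ⟨_, HasCompactSupport.intro (isCompact_Icc (a := a) (b := b)) fun _ hx =>
    indicator_of_notMem (fun hx' => hx (Ioc_subset_Icc_self hx')) _, hf⟩

theorem intervalIntegrable_mul_conj (f g : L2) (a b : ℝ) :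
    IntervalIntegrable (fun x => f x * conj (g x)) volume a b :=
  (L2.integrable_inner (𝕜 := ℂ) g f).intervalIntegrable

theorem locallyIntegrable_coe (f : L2) : LocallyIntegrable f volume :=
  (Lp.memLp f).locallyIntegrable one_le_two

variable {α γ : ℝ → ℝ} {β u v w z : ℝ → ℂ} {f g h : L2}

theorem IsWeakL2Solution.inner_eq_zero (hfg : IsWeakL2Solution α β γ f g) {a b : ℝ} (hab : a ≤ b)
    (hwz : IsSolution α β γ g w z) (huv : IsSolution α β γ h u v) (hua : u a = 0) (hva : v a = 0)
    (hub : u b = 0) (hvb : v b = 0) {F : L2}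
    (hF : F =ᵐ[volume] (Ioc a b).indicator fun x => f x - w x) : inner ℂ F h = 0 := by
  have hU := (memLp_indicator_Ioc huv.fst.continuous a b).coeFn_toLp
  have hH := ((Lp.memLp h).indicator (measurableSet_Ioc (a := a) (b := b))).coeFn_toLp
  have hweak : ∫ x in a..b, f x * conj (h x) = ∫ x in a..b, g x * conj (u x) := by
    rw [← inner_indicator_Ioc_eq_integral hab hH, ← inner_indicator_Ioc_eq_integral hab hU]
    exact hfg _ _ ⟨_, _, (huv.indicator_Ioc hab hua hva hub hvb).congr_rhs hH.symm, hU⟩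
      (mem_compactlySupported_of_ae_eq_indicator_Ioc hU)
  have hgu : IntervalIntegrable (fun x => g x * conj (u x)) volume a b :=
    (intervalIntegrable_of_locallyIntegrable (locallyIntegrable_coe g) a b).mul_continuousOn
      huv.fst.conjugate.continuous.continuousOn
  have hwh : IntervalIntegrable (fun x => w x * conj (h x)) volume a b := by
    simpa only [sub_sub_cancel] using
      hgu.sub ((hwz.green huv).intervalIntegrable_and_integral_eq a b).1
  have hgreen : ∫ x in a..b, g x * conj (u x) = ∫ x in a..b, w x * conj (h x) := by
    rw [← sub_eq_zero, ← intervalIntegral.integral_sub hgu hwh, (hwz.green huv).integral_eq a b]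
    simp only [hua, hva, hub, hvb, map_zero, mul_zero, sub_zero]
  have hdiff : ∫ x in a..b, (f x - w x) * conj (h x) = 0 := by
    simp only [sub_mul]
    rw [intervalIntegral.integral_sub (intervalIntegrable_mul_conj f h a b) hwh, hweak, hgreen,
      sub_self]
  rw [inner_indicator_Ioc_eq_integral hab hF, ← map_zero conj, ← hdiff,
    intervalIntegral.integral_of_le hab, intervalIntegral.integral_of_le hab, ← integral_conj]
  simp only [map_mul, Complex.conj_conj, mul_comm]

variable (hα : LocallyIntegrable α volume) (hβ : LocallyIntegrable β volume)
  (hγ : LocallyIntegrable γ volume)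

include hα hβ hγ

theorem IsWeakL2Solution.mem_span_pair (hfg : IsWeakL2Solution α β γ f g) {a b : ℝ} (hab : a ≤ b)
    (hwz : IsSolution α β γ g w z) {F e₁ e₂ : L2} {y₁ z₁ y₂ z₂ : ℝ → ℂ}
    (hyz₁ : IsSolution α β γ 0 y₁ z₁) (hy₁ : y₁ b = 1) (hz₁ : z₁ b = 0)
    (hyz₂ : IsSolution α β γ 0 y₂ z₂) (hy₂ : y₂ b = 0) (hz₂ : z₂ b = 1)
    (he₁ : e₁ =ᵐ[volume] (Ioc a b).indicator y₁) (he₂ : e₂ =ᵐ[volume] (Ioc a b).indicator y₂)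
    (hF : F =ᵐ[volume] (Ioc a b).indicator fun x => f x - w x) :
    F ∈ Submodule.span ℂ {e₁, e₂} := by
  have : FiniteDimensional ℂ (Submodule.span ℂ {e₁, e₂}) :=
    FiniteDimensional.span_of_finite ℂ (toFinite _)
  rw [← Submodule.orthogonal_orthogonal (Submodule.span ℂ {e₁, e₂}), Submodule.mem_orthogonal']
  intro h hh
  have horth {e : L2} {y : ℝ → ℂ} (hmem : e ∈ ({e₁, e₂} : Set L2))
      (he : e =ᵐ[volume] (Ioc a b).indicator y) : ∫ x in a..b, h x * conj (y x) = 0 := by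
    rw [← inner_indicator_Ioc_eq_integral hab he, hh e (Submodule.subset_span hmem)]
  obtain ⟨u, v, huv, hua, hva⟩ := exists_isSolution hα hβ hγ (locallyIntegrable_coe h) a 0 0
  have hvb := huv.mul_conj_eq_of_orthogonal hyz₁ hua hva (horth (by simp) he₁)
  have hub := huv.mul_conj_eq_of_orthogonal hyz₂ hua hva (horth (by simp) he₂)
  exact hfg.inner_eq_zero hab hwz huv hua hva (by simpa [hy₂, hz₂] using hub)
    (by simpa [hy₁, hz₁] using hvb.symm) hF

theorem IsWeakL2Solution.exists_isSolution_Ioc (hfg : IsWeakL2Solution α β γ f g) {a b : ℝ}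
    (hab : a ≤ b) : ∃ u v, IsSolution α β γ g u v ∧ ∀ᵐ x, x ∈ Ioc a b → f x = u x := by
  obtain ⟨w, z, hwz, -, -⟩ := exists_isSolution hα hβ hγ (locallyIntegrable_coe g) a 0 0
  obtain ⟨y₁, z₁, hyz₁, hy₁, hz₁⟩ := exists_isSolution hα hβ hγ locallyIntegrable_zero b 1 0
  obtain ⟨y₂, z₂, hyz₂, hy₂, hz₂⟩ := exists_isSolution hα hβ hγ locallyIntegrable_zero b 0 1
  have hmem : MemLp ((Ioc a b).indicator fun x => f x - w x) 2 volume := by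
    rw [indicator_sub]
    exact ((Lp.memLp f).indicator measurableSet_Ioc).sub
      (memLp_indicator_Ioc hwz.fst.continuous a b)
  set e₁ : L2 := (memLp_indicator_Ioc hyz₁.fst.continuous a b).toLp
  set e₂ : L2 := (memLp_indicator_Ioc hyz₂.fst.continuous a b).toLp
  have he₁ : e₁ =ᵐ[volume] (Ioc a b).indicator y₁ := MemLp.coeFn_toLp _
  have he₂ : e₂ =ᵐ[volume] (Ioc a b).indicator y₂ := MemLp.coeFn_toLp _
  obtain ⟨c₁, c₂, hc⟩ := Submodule.mem_span_pair.1 <| hfg.mem_span_pair hα hβ hγ hab hwz hyz₁ hy₁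
    hz₁ hyz₂ hy₂ hz₂ he₁ he₂ hmem.coeFn_toLp
  refine ⟨_, _, (hwz.add_const_mul c₁ hyz₁).add_const_mul c₂ hyz₂, ?_⟩
  filter_upwards [he₁, he₂, hmem.coeFn_toLp, Lp.coeFn_add (c₁ • e₁) (c₂ • e₂),
    Lp.coeFn_smul c₁ e₁, Lp.coeFn_smul c₂ e₂] with x h₁ h₂ hF hadd hsmul₁ hsmul₂ hx
  rw [← hc, hadd, Pi.add_apply, hsmul₁, hsmul₂, Pi.smul_apply, Pi.smul_apply, h₁, h₂] at hF
  simp only [indicator_of_mem hx, smul_eq_mul] at hF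
  linear_combination -hF

theorem IsWeakL2Solution.isL2Solution (hα₀ : ∀ᵐ x, α x ≠ 0) (hfg : IsWeakL2Solution α β γ f g) :
    IsL2Solution α β γ f g := by
  choose u v huv hfu using fun n : ℕ =>
    hfg.exists_isSolution_Ioc hα hβ hγ (neg_le_self n.cast_add_one_pos.le : -(n + 1 : ℝ) ≤ n + 1)
  have hu (n : ℕ) : u n = u 0 := by
    refine (huv n).fst_eq_of_ae_eq hα hβ hγ hα₀ (huv 0) (isOpen_Ioo (a := (-1 : ℝ)) (b := 1))
      (nonempty_Ioo.2 (by norm_num)) ((ae_restrict_iff' measurableSet_Ioo).2 ?_)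
    filter_upwards [hfu n, hfu 0] with x hn h0 hx
    have : (0 : ℝ) ≤ n := n.cast_nonneg
    exact (hn ⟨by linarith [hx.1], by linarith [hx.2]⟩).symm.trans
      (h0 ⟨by simpa using hx.1, by simpa using hx.2.le⟩)
  refine ⟨u 0, v 0, huv 0, ?_⟩
  filter_upwards [ae_all_iff.2 hfu] with x hx
  obtain ⟨n, hn⟩ := exists_nat_ge |x|
  rw [← hu n]
  exact hx n ⟨by linarith [(abs_le.1 hn).1], by linarith [(abs_le.1 hn).2]⟩

end Regularity

section Energy

open scoped ComplexConjugate

variable {α γ : ℝ → ℝ} {β g u v : ℝ → ℂ}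

theorem norm_sq_eq_integral {f : L2} (hf : f =ᵐ[volume] u) : ‖f‖ ^ 2 = ∫ x, ‖u x‖ ^ 2 := by
  have h : ((‖f‖ ^ 2 : ℝ) : ℂ) = ((∫ x, ‖u x‖ ^ 2 : ℝ) : ℂ) := by
    rw [← integral_complex_ofReal, Complex.ofReal_pow]
    refine (inner_self_eq_norm_sq_to_K f).symm.trans ((inner_eq_integral hf hf).trans ?_)
    exact integral_congr_ae (Eventually.of_forall fun x => by simp only [Complex.mul_conj,
      Complex.normSq_eq_norm_sq])
  exact_mod_cast h

theorem IsL2Solution.isWeakL2Solution (hα₀ : ∀ᵐ x, α x ≠ 0) {f g : L2}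
    (hfg : IsL2Solution α β γ f g) : IsWeakL2Solution α β γ f g := by
  rintro F G ⟨u, v, huv, hFu⟩ ⟨k, hk, hFk⟩
  obtain ⟨w, z, hwz, hfw⟩ := hfg
  have hu : ∀ x ∈ (tsupport k)ᶜ, u x = 0 := by
    refine Measure.eqOn_open_of_ae_eq (μ := volume) (g := fun _ => 0) ?_
      (isClosed_tsupport k).isOpen_compl huv.fst.continuous.continuousOn continuousOn_const
    refine (ae_restrict_iff' (isClosed_tsupport k).measurableSet.compl).2 ?_
    filter_upwards [hFu, hFk] with x h₁ h₂ hx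
    rw [← h₁, h₂, image_eq_zero_of_notMem_tsupport hx]
  have hv := huv.snd_eq_zero_of_fst_eq_zero hα₀ (isClosed_tsupport k).isOpen_compl hu
  have hgreen := (hwz.green huv).integral_eq_zero_of_hasCompactSupport
    (HasCompactSupport.intro hk fun x hx => by rw [hu x hx, hv x hx]; simp)
  have hgu : Integrable (fun x => g x * conj (u x)) volume :=
    (L2.integrable_inner (𝕜 := ℂ) F g).congr (hFu.mono fun x hx => by
      simp only [RCLike.inner_apply, hx])
  have hwG : Integrable (fun x => w x * conj (G x)) volume :=
    (L2.integrable_inner (𝕜 := ℂ) G f).congr (hfw.mono fun x hx => by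
      simp only [RCLike.inner_apply, hx])
  rw [inner_eq_integral (EventuallyEq.refl _ _) hfw,
    inner_eq_integral hFu (EventuallyEq.refl _ _)]
  exact (sub_eq_zero.1 ((integral_sub hgu hwG).symm.trans hgreen)).symm

/-- A pair of compactly supported cutoff functions with `φ' = α ψ`, so that multiplication by `φ`
preserves the first order system, with `ψ` correcting the quasi-derivative. -/
structure IsCutoff (α φ ψ : ℝ → ℝ) : Prop where
  contDiff_fst : ContDiff ℝ 1 φ
  contDiff_snd : ContDiff ℝ 1 ψ
  hasCompactSupport_fst : HasCompactSupport φ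
  hasCompactSupport_snd : HasCompactSupport ψ
  deriv_fst : ∀ x, deriv φ x = α x * ψ x

/-- The right-hand side of the first order system satisfied by the first component `φ u` when
`(u, v)` is a solution with right-hand side `g` and `φ' = α ψ`. -/
def cutoffSource (α : ℝ → ℝ) (β : ℝ → ℂ) (φ ψ : ℝ → ℝ) (g u v : ℝ → ℂ) (x : ℝ) : ℂ :=
  φ x * g x - 2 * (α x * ψ x) * v x - (deriv ψ x : ℝ) * u x - (β x).re * (2 * (ψ x * u x))

variable {φ ψ : ℝ → ℝ}

theorem IsSolution.cutoff (huv : IsSolution α β γ g u v) (hc : IsCutoff α φ ψ) :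
    IsSolution α β γ (cutoffSource α β φ ψ g u v) (fun x => φ x * u x)
      (fun x => φ x * v x + ψ x * u x) where
  fst := ((IsPrimitive.ofReal_of_contDiff hc.contDiff_fst).mul huv.fst).congr <|
    Eventually.of_forall fun x => by
      simp only [hc.deriv_fst]
      push_cast
      ring
  snd := (((IsPrimitive.ofReal_of_contDiff hc.contDiff_fst).mul huv.snd).add
      ((IsPrimitive.ofReal_of_contDiff hc.contDiff_snd).mul huv.fst)).congr <|
    Eventually.of_forall fun x => by
      have hre : ((β x).re : ℂ) = (β x + conj (β x)) / 2 := by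
        rw [Complex.add_conj]; push_cast; ring
      simp only [cutoffSource, hc.deriv_fst, hre]
      push_cast
      ring

theorem memLp_mul_of_memL2Loc {k : ℝ → ℝ} {y : ℝ → ℂ} (hk : MemL2Loc k) (hy : Continuous y)
    (hys : HasCompactSupport y) : MemLp (fun x => (k x : ℂ) * y x) 2 volume := by
  obtain ⟨C, hC⟩ := hy.bounded_above_of_compact_support hys
  have hself : (tsupport y).indicator (fun x => (k x : ℂ) * y x) = fun x => (k x : ℂ) * y x :=
    indicator_eq_self.2 ((Function.support_mul_subset_right _ _).trans (subset_tsupport y))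
  have hkK := hk (tsupport y) hys
  rw [← hself, memLp_indicator_iff_restrict (isClosed_tsupport y).measurableSet]
  refine hkK.of_le_mul (c := C) ((Complex.continuous_ofReal.comp_aestronglyMeasurable
    hkK.aestronglyMeasurable).mul hy.aestronglyMeasurable) (Eventually.of_forall fun x => ?_)
  rw [norm_mul, Complex.norm_real, mul_comm]
  exact mul_le_mul_of_nonneg_right (hC x) (norm_nonneg _)

theorem memLp_cutoffSource (hα : Continuous α) (hβ : MemL2Loc fun x => (β x).re)
    (hg : Continuous g) (hu : Continuous u) (hv : Continuous v) (hc : IsCutoff α φ ψ) :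
    MemLp (cutoffSource α β φ ψ g u v) 2 volume := by
  have hφ := hc.contDiff_fst.continuous
  have hψ := hc.contDiff_snd.continuous
  have hψ' : Continuous (deriv ψ) := hc.contDiff_snd.continuous_deriv le_rfl
  have hφs : HasCompactSupport fun x => (φ x : ℂ) :=
    hc.hasCompactSupport_fst.comp_left Complex.ofReal_zero
  have hψs : HasCompactSupport fun x => (ψ x : ℂ) :=
    hc.hasCompactSupport_snd.comp_left Complex.ofReal_zero
  have hψs' : HasCompactSupport fun x => ((deriv ψ x : ℝ) : ℂ) :=
    hc.hasCompactSupport_snd.deriv.comp_left Complex.ofReal_zero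
  exact (((Continuous.memLp_of_hasCompactSupport (by fun_prop) hφs.mul_right).sub
    (Continuous.memLp_of_hasCompactSupport (by fun_prop)
      ((hψs.mul_left (f := fun x => (α x : ℂ))).mul_left (f := fun _ => 2)).mul_right)).sub
    (Continuous.memLp_of_hasCompactSupport (by fun_prop) hψs'.mul_right)).sub
    (memLp_mul_of_memL2Loc hβ (by fun_prop) (hψs.mul_right.mul_left (f := fun _ => 2)))

/-- The localization formula: up to a total derivative, the energy density of `φ u` is
`φ² Re (u ḡ) + α ψ² |u|²`. -/
theorem IsSolution.isPrimitive_cutoff (huv : IsSolution α β γ g u v) (hc : IsCutoff α φ ψ) :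
    IsPrimitive (fun x => (φ x : ℂ) * ψ x * (u x * conj (u x))) fun x =>
      ((φ x ^ 2 * (u x * conj (g x)).re + α x * ψ x ^ 2 * ‖u x‖ ^ 2
        - (φ x * u x * conj (cutoffSource α β φ ψ g u v x)).re : ℝ) : ℂ) := by
  refine (((IsPrimitive.ofReal_of_contDiff hc.contDiff_fst).mul
    (IsPrimitive.ofReal_of_contDiff hc.contDiff_snd)).mul
    (huv.fst.mul huv.fst.conjugate)).congr (Eventually.of_forall fun x => ?_)
  apply Complex.ext <;>
  · simp only [cutoffSource, hc.deriv_fst, Complex.sq_norm, Complex.normSq_apply, Complex.mul_re,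
      Complex.mul_im, Complex.add_re, Complex.add_im, Complex.sub_re, Complex.sub_im,
      Complex.conj_re, Complex.conj_im, Complex.ofReal_re, Complex.ofReal_im, Complex.re_ofNat,
      Complex.im_ofNat]
    ring

theorem re_inner_cutoffSource (hα : Continuous α) (hg : Continuous g)
    (huv : IsSolution α β γ g u v) (hc : IsCutoff α φ ψ) {F G : L2}
    (hF : F =ᵐ[volume] fun x => φ x * u x) (hG : G =ᵐ[volume] cutoffSource α β φ ψ g u v) :
    (inner ℂ G F).re =
      ∫ x, (φ x ^ 2 * (u x * conj (g x)).re + α x * ψ x ^ 2 * ‖u x‖ ^ 2) := by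
  have hu := huv.fst.continuous
  have hφ := hc.contDiff_fst.continuous
  have hψ := hc.contDiff_snd.continuous
  have hFG : Integrable (fun x => φ x * u x * conj (cutoffSource α β φ ψ g u v x)) volume := by
    refine (L2.integrable_inner (𝕜 := ℂ) G F).congr ?_
    filter_upwards [hF, hG] with x h₁ h₂
    rw [RCLike.inner_apply, h₁, h₂]
  have hFGre : Integrable (fun x => (φ x * u x * conj (cutoffSource α β φ ψ g u v x)).re)
      volume := hFG.re
  have hint : Integrable (fun x => φ x ^ 2 * (u x * conj (g x)).re + α x * ψ x ^ 2 * ‖u x‖ ^ 2)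
      volume := by
    refine Continuous.integrable_of_hasCompactSupport (by fun_prop) (HasCompactSupport.add ?_ ?_)
    · exact (hc.hasCompactSupport_fst.comp_left (g := (· ^ 2)) (by simp)).mul_right
    · exact ((hc.hasCompactSupport_snd.comp_left (g := (· ^ 2)) (by simp)).mul_left).mul_right
  have hzero := (huv.isPrimitive_cutoff hc).integral_eq_zero_of_hasCompactSupport
    ((hc.hasCompactSupport_fst.comp_left Complex.ofReal_zero).mul_right.mul_right)
  rw [integral_complex_ofReal, Complex.ofReal_eq_zero, integral_sub hint hFGre, sub_eq_zero]
    at hzero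
  rw [hzero, inner_eq_integral hG hF]
  exact (integral_re hFG).symm

/-- The lower bound `c` for the quadratic form of the compactly supported part of the maximal
relation. -/
def IsLowerBound (α : ℝ → ℝ) (β : ℝ → ℂ) (γ : ℝ → ℝ) (c : ℝ) : Prop :=
  ∀ F G : L2, IsL2Solution α β γ F G → F ∈ compactlySupported → c * ‖F‖ ^ 2 ≤ (inner ℂ G F).re

theorem IsLowerBound.energy_le (hα : Continuous α) (hβ : MemL2Loc fun x => (β x).re) {c μ : ℝ}
    (hbdd : IsLowerBound α β γ c) (huv : IsSolution α β γ (fun x => μ * u x) u v)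
    (hc : IsCutoff α φ ψ) :
    (c - μ) * ∫ x, φ x ^ 2 * ‖u x‖ ^ 2 ≤ ∫ x, α x * ψ x ^ 2 * ‖u x‖ ^ 2 := by
  have hu := huv.fst.continuous
  have hφ := hc.contDiff_fst.continuous
  have hψ := hc.contDiff_snd.continuous
  have hμu : Continuous fun x => (μ : ℂ) * u x := by fun_prop
  have hφs : HasCompactSupport fun x => (φ x : ℂ) * u x :=
    (hc.hasCompactSupport_fst.comp_left Complex.ofReal_zero).mul_right
  have hF := (Continuous.memLp_of_hasCompactSupport (μ := volume) (p := 2) (by fun_prop)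
    hφs).coeFn_toLp
  have hG := (memLp_cutoffSource hα hβ hμu hu huv.snd.continuous hc).coeFn_toLp
  have hlow := hbdd _ _ ⟨_, _, (huv.cutoff hc).congr_rhs hG.symm, hF⟩ ⟨_, hφs, hF⟩
  have hφi : Integrable (fun x => φ x ^ 2 * ‖u x‖ ^ 2) volume :=
    Continuous.integrable_of_hasCompactSupport (by fun_prop)
      (hc.hasCompactSupport_fst.comp_left (g := (· ^ 2)) (by simp)).mul_right
  have hψi : Integrable (fun x => α x * ψ x ^ 2 * ‖u x‖ ^ 2) volume :=
    Continuous.integrable_of_hasCompactSupport (by fun_prop)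
      ((hc.hasCompactSupport_snd.comp_left (g := (· ^ 2)) (by simp)).mul_left).mul_right
  have hre (x : ℝ) : φ x ^ 2 * (u x * conj (μ * u x)).re = μ * (φ x ^ 2 * ‖u x‖ ^ 2) := by
    rw [map_mul, Complex.conj_ofReal, mul_left_comm, Complex.mul_conj, ← Complex.ofReal_mul,
      Complex.ofReal_re, Complex.normSq_eq_norm_sq, mul_left_comm]
  have hnorm (x : ℝ) : ‖φ x * u x‖ ^ 2 = φ x ^ 2 * ‖u x‖ ^ 2 := by
    rw [norm_mul, mul_pow, Complex.norm_real, Real.norm_eq_abs, sq_abs]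
  simp only [norm_sq_eq_integral hF, hnorm, re_inner_cutoffSource hα hμu huv hc hF hG, hre] at hlow
  rw [integral_add (hφi.const_mul μ) hψi, integral_const_mul] at hlow
  linarith

/-- Cutoffs that are `1` on arbitrarily large intervals and have arbitrarily small energy
density. -/
def HasSlowCutoffs (α : ℝ → ℝ) : Prop :=
  ∀ R ε : ℝ, 0 < ε →
    ∃ φ ψ, IsCutoff α φ ψ ∧ (∀ x, α x * ψ x ^ 2 ≤ ε) ∧ ∀ x ∈ Icc (-R) R, φ x = 1

theorem IsLowerBound.setIntegral_norm_sq_le (hα : Continuous α) (hα₀ : ∀ x, 0 ≤ α x)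
    (hβ : MemL2Loc fun x => (β x).re) {c μ ε : ℝ} (hμ : μ < c) (hbdd : IsLowerBound α β γ c)
    (huv : IsSolution α β γ (fun x => μ * u x) u v) (hu2 : Integrable (fun x => ‖u x‖ ^ 2) volume)
    (hc : IsCutoff α φ ψ) (hψ : ∀ x, α x * ψ x ^ 2 ≤ ε) {s : Set ℝ} (hs : MeasurableSet s)
    (hφ : ∀ x ∈ s, φ x = 1) :
    (c - μ) * ∫ x in s, ‖u x‖ ^ 2 ≤ ε * ∫ x, ‖u x‖ ^ 2 := by
  have hu := huv.fst.continuous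
  have hφc := hc.contDiff_fst.continuous
  have hφi : Integrable (fun x => φ x ^ 2 * ‖u x‖ ^ 2) volume :=
    Continuous.integrable_of_hasCompactSupport (by fun_prop)
      (hc.hasCompactSupport_fst.comp_left (g := (· ^ 2)) (by simp)).mul_right
  have hlocal : ∫ x in s, ‖u x‖ ^ 2 ≤ ∫ x, φ x ^ 2 * ‖u x‖ ^ 2 :=
    calc ∫ x in s, ‖u x‖ ^ 2 = ∫ x in s, φ x ^ 2 * ‖u x‖ ^ 2 :=
          setIntegral_congr_fun hs fun x hx => by simp only [hφ x hx, one_pow, one_mul]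
      _ ≤ ∫ x, φ x ^ 2 * ‖u x‖ ^ 2 :=
          setIntegral_le_integral hφi (Eventually.of_forall fun x => by positivity)
  calc (c - μ) * ∫ x in s, ‖u x‖ ^ 2 ≤ (c - μ) * ∫ x, φ x ^ 2 * ‖u x‖ ^ 2 :=
        mul_le_mul_of_nonneg_left hlocal (sub_pos.2 hμ).le
    _ ≤ ∫ x, α x * ψ x ^ 2 * ‖u x‖ ^ 2 := hbdd.energy_le hα hβ huv hc
    _ ≤ ∫ x, ε * ‖u x‖ ^ 2 :=
        integral_mono_of_nonneg
          (Eventually.of_forall fun x =>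
            mul_nonneg (mul_nonneg (hα₀ x) (sq_nonneg _)) (sq_nonneg _))
          (hu2.const_mul ε)
          (Eventually.of_forall fun x => mul_le_mul_of_nonneg_right (hψ x) (sq_nonneg _))
    _ = ε * ∫ x, ‖u x‖ ^ 2 := integral_const_mul ε _

theorem IsLowerBound.eq_zero_of_isL2Solution_smul (hα : Continuous α) (hα₀ : ∀ x, 0 ≤ α x)
    (hβ : MemL2Loc fun x => (β x).re) {c μ : ℝ} (hμ : μ < c) (hbdd : IsLowerBound α β γ c)
    (hcut : HasSlowCutoffs α) {f : L2} (hf : IsL2Solution α β γ f ((μ : ℂ) • f)) : f = 0 := by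
  obtain ⟨u, v, huv, hfu⟩ := hf
  have huv' : IsSolution α β γ (fun x => μ * u x) u v := huv.congr_rhs <| by
    filter_upwards [hfu, Lp.coeFn_smul (μ : ℂ) f] with x h₁ h₂
    rw [h₂, Pi.smul_apply, h₁, smul_eq_mul]
  have hu2 : Integrable (fun x => ‖u x‖ ^ 2) volume :=
    ((memLp_congr_ae hfu).1 (Lp.memLp f)).integrable_norm_pow two_ne_zero
  have hhalf (R : ℝ) (hR : 0 ≤ R) : ∫ x in (-R)..R, ‖u x‖ ^ 2 ≤ 1 / 2 * ‖f‖ ^ 2 := by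
    obtain ⟨φ, ψ, hc, hψ, hφ⟩ := hcut R ((c - μ) / 2) (half_pos (sub_pos.2 hμ))
    have h := hbdd.setIntegral_norm_sq_le hα hα₀ hβ hμ huv' hu2 hc hψ measurableSet_Ioc
      fun x hx => hφ x (Ioc_subset_Icc_self hx)
    rw [← norm_sq_eq_integral hfu, ← intervalIntegral.integral_of_le (neg_le_self hR)] at h
    exact le_of_mul_le_mul_left (by linarith) (sub_pos.2 hμ)
  have hle := le_of_tendsto (intervalIntegral_tendsto_integral hu2 tendsto_neg_atTop_atBot
    tendsto_id) ((eventually_ge_atTop 0).mono hhalf)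
  rw [← norm_sq_eq_integral hfu] at hle
  have hzero : ‖f‖ ^ 2 = 0 := le_antisymm (by linarith) (sq_nonneg _)
  exact norm_eq_zero.1 (pow_eq_zero_iff two_ne_zero |>.1 hzero)

end Energy

section Cutoff

variable {α ρ P χ k : ℝ → ℝ}

theorem tendsto_integral_atTop_of_lintegral_Ici_eq_top (hk : LocallyIntegrable k volume)
    (hk₀ : ∀ x, 0 ≤ k x) (htop : ∫⁻ t in Ici (0 : ℝ), ENNReal.ofReal (k t) = ⊤) :
    Tendsto (fun x => ∫ t in (0 : ℝ)..x, k t) atTop atTop := by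
  have hki := intervalIntegrable_of_locallyIntegrable hk
  have hmono : Monotone fun x => ∫ t in (0 : ℝ)..x, k t := fun x y hxy => by
    rw [← sub_nonneg, intervalIntegral.integral_interval_sub_left (hki _ _) (hki _ _)]
    exact intervalIntegral.integral_nonneg hxy fun t _ => hk₀ t
  refine tendsto_atTop_atTop_of_monotone' hmono ?_
  rintro ⟨M, hM⟩
  have hint : IntegrableOn k (Ioi 0) volume :=
    integrableOn_Ioi_of_intervalIntegral_norm_bounded M 0 (b := id) (l := atTop)
      (fun x => (hki 0 x).1) tendsto_id <| Eventually.of_forall fun x => by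
        simpa only [Real.norm_of_nonneg (hk₀ _), id] using hM (mem_range_self x)
  rw [setLIntegral_congr Ioi_ae_eq_Ici.symm,
    ← ofReal_integral_eq_lintegral_ofReal hint (Eventually.of_forall hk₀)] at htop
  exact ENNReal.ofReal_ne_top htop

theorem tendsto_integral_atBot_of_lintegral_Iic_eq_top (hk : LocallyIntegrable k volume)
    (hk₀ : ∀ x, 0 ≤ k x) (htop : ∫⁻ t in Iic (0 : ℝ), ENNReal.ofReal (k t) = ⊤) :
    Tendsto (fun x => ∫ t in (0 : ℝ)..x, k t) atBot atBot := by
  have htop' : ∫⁻ t in Ici (0 : ℝ), ENNReal.ofReal (k (-t)) = ⊤ := by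
    have h := (Measure.measurePreserving_neg (volume : Measure ℝ)).setLIntegral_comp_emb
      (MeasurableEquiv.neg ℝ).measurableEmbedding (fun t => ENNReal.ofReal (k (-t))) (Iic 0)
    simp only [neg_neg, image_neg_eq_neg, neg_Iic, neg_zero] at h
    rw [← h, htop]
  have hk' : LocallyIntegrable (fun x => k (-x)) volume :=
    locallyIntegrable_of_intervalIntegrable fun a b =>
      (IntervalIntegrable.iff_comp_neg (f := fun x => k (-x))).2 <| by
        simpa only [neg_neg] using intervalIntegrable_of_locallyIntegrable hk (-a) (-b)
  have h := tendsto_neg_atTop_atBot.comp ((tendsto_integral_atTop_of_lintegral_Ici_eq_top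
    hk' (fun x => hk₀ (-x)) htop').comp tendsto_neg_atBot_atTop)
  refine h.congr fun x => ?_
  simp only [Function.comp_apply, intervalIntegral.integral_comp_neg, neg_neg, neg_zero]
  rw [← intervalIntegral.integral_symm]

theorem lintegral_ofReal_eq_top_of_le_mul (hk : Continuous k) {h : ℝ → ℝ} {C : ℝ} (hC : 0 ≤ C)
    (hle : ∀ x, h x ≤ C * k x) {s : Set ℝ} (hs : ∫⁻ t in s, ENNReal.ofReal (h t) = ⊤) :
    ∫⁻ t in s, ENNReal.ofReal (k t) = ⊤ := by
  have hmono : ∫⁻ t in s, ENNReal.ofReal (h t) ≤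
      ENNReal.ofReal C * ∫⁻ t in s, ENNReal.ofReal (k t) := by
    rw [← lintegral_const_mul _ hk.measurable.ennreal_ofReal]
    refine lintegral_mono fun t => ?_
    rw [← ENNReal.ofReal_mul hC]
    exact ENNReal.ofReal_le_ofReal (hle t)
  by_contra hne
  exact (ENNReal.mul_lt_top ENNReal.ofReal_lt_top (lt_top_iff_ne_top.2 hne)).ne
    (top_le_iff.1 (hs ▸ hmono))

theorem hasCompactSupport_comp_of_tendsto_cocompact {X Y E : Type*} [TopologicalSpace X] [R1Space X]
    [TopologicalSpace Y] [R1Space Y] [Zero E] {f : Y → E} (hf : HasCompactSupport f) {m : X → Y}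
    (hm : Tendsto m (cocompact X) (cocompact Y)) : HasCompactSupport fun x => f (m x) := by
  rw [hasCompactSupport_iff_eventuallyEq, coclosedCompact_eq_cocompact] at hf ⊢
  exact hm.eventually hf

theorem contDiff_one_of_hasDerivAt (hk : Continuous k) (hP : ∀ x, HasDerivAt P (k x) x) :
    ContDiff ℝ 1 P := by
  rw [contDiff_one_iff_deriv, deriv_eq hP]
  exact ⟨fun x => (hP x).differentiableAt, hk⟩

theorem isCutoff_comp (hα : Continuous α) (hρ : ContDiff ℝ 1 ρ) (hχ : ContDiff ℝ 2 χ)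
    (hχs : HasCompactSupport χ) (hP : ∀ x, HasDerivAt P (α x * ρ x) x)
    (hPc : Tendsto P (cocompact ℝ) (cocompact ℝ)) :
    IsCutoff α (fun x => χ (P x)) (fun x => deriv χ (P x) * ρ x) where
  contDiff_fst := (hχ.of_le one_le_two).comp (contDiff_one_of_hasDerivAt (by fun_prop) hP)
  contDiff_snd := (((contDiff_succ_iff_deriv (n := 1)).1 (by exact_mod_cast hχ)).2.2.comp
    (contDiff_one_of_hasDerivAt (by fun_prop) hP)).mul hρ
  hasCompactSupport_fst := hasCompactSupport_comp_of_tendsto_cocompact hχs hPc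
  hasCompactSupport_snd :=
    (hasCompactSupport_comp_of_tendsto_cocompact hχs.deriv hPc).mul_right
  deriv_fst x := by
    have hχx := (hχ.differentiable two_ne_zero (P x)).hasDerivAt
    exact (hχx.comp x (hP x)).deriv.trans (mul_left_comm _ _ _)

theorem hasSlowCutoffs_of_hasDerivAt (hα : Continuous α) (hρ : ContDiff ℝ 1 ρ)
    (hαρ : ∀ x, α x * ρ x ^ 2 ≤ 1) (hP : ∀ x, HasDerivAt P (α x * ρ x) x)
    (hbot : Tendsto P atBot atBot) (htop : Tendsto P atTop atTop) : HasSlowCutoffs α := by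
  let χ : ContDiffBump (0 : ℝ) := ⟨1, 2, one_pos, one_lt_two⟩
  have hχ : ContDiff ℝ 2 χ := χ.contDiff
  obtain ⟨C, hC⟩ := (hχ.continuous_deriv one_le_two).bounded_above_of_compact_support
    χ.hasCompactSupport.deriv
  intro R ε hε
  obtain ⟨B, hB⟩ := (isCompact_Icc (a := -R) (b := R)).exists_bound_of_continuousOn
    (fun x _ => (hP x).continuousAt.continuousWithinAt)
  have hCε : ∀ᶠ N : ℝ in atTop, C ^ 2 / N ^ 2 ≤ ε :=
    (tendsto_const_nhds.div_atTop (tendsto_pow_atTop two_ne_zero)).eventually_le_const hε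
  obtain ⟨N, ⟨hCN, hBN⟩, hN⟩ :=
    ((hCε.and (eventually_ge_atTop B)).and (eventually_gt_atTop 0)).exists
  refine ⟨_, _, isCutoff_comp hα (hρ.div_const N) hχ χ.hasCompactSupport (P := fun x => P x / N)
    (fun x => ((hP x).div_const N).congr_deriv (mul_div_assoc _ _ _)) ?_, fun x => ?_,
    fun x hx => ?_⟩
  · rw [cocompact_eq_atBot_atTop, tendsto_sup]
    exact ⟨(hbot.atBot_div_const hN).mono_right le_sup_left,
      (htop.atTop_div_const hN).mono_right le_sup_right⟩
  · have hC' : deriv χ (P x / N) ^ 2 ≤ C ^ 2 := sq_le_sq' (abs_le.1 (hC _)).1 (abs_le.1 (hC _)).2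
    calc α x * (deriv χ (P x / N) * (ρ x / N)) ^ 2
        = α x * ρ x ^ 2 * (deriv χ (P x / N) ^ 2 / N ^ 2) := by ring
      _ ≤ 1 * (C ^ 2 / N ^ 2) :=
          mul_le_mul (hαρ x) (div_le_div_of_nonneg_right hC' (sq_nonneg N)) (by positivity)
            zero_le_one
      _ ≤ ε := by rwa [one_mul]
  · refine χ.one_of_mem_closedBall ?_
    rw [Metric.mem_closedBall, dist_zero_right, norm_div, Real.norm_of_nonneg hN.le]
    exact (div_le_one₀ hN).2 ((hB x hx).trans hBN)

theorem exists_contDiff_approx_inv_sqrt (hα : Continuous α) (hα₀ : ∀ x, 0 < α x) :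
    ∃ ρ, ContDiff ℝ 1 ρ ∧ (∀ x, √(α x) ≤ 2 * (α x * ρ x)) ∧ ∀ x, α x * ρ x ^ 2 ≤ 1 := by
  have hpos (x : ℝ) : 0 < √(α x) := Real.sqrt_pos.2 (hα₀ x)
  have hcont : Continuous fun x => (√(α x))⁻¹ := hα.sqrt.inv₀ fun x => (hpos x).ne'
  obtain ⟨ρ, hρ, hdist, -⟩ := Continuous.exists_contDiff_approx 1
    (f := fun x => 3 / 4 * (√(α x))⁻¹) (ε := fun x => 1 / 4 * (√(α x))⁻¹) (by fun_prop)
    (by fun_prop) fun x => by have := hpos x; positivity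
  have hρ' (x : ℝ) : 1 / 2 ≤ √(α x) * ρ x ∧ √(α x) * ρ x ≤ 1 := by
    have h := abs_lt.1 (Real.dist_eq (ρ x) _ ▸ hdist x)
    have hlow : 1 / 2 * (√(α x))⁻¹ ≤ ρ x := by linarith [h.1]
    have hupp : ρ x ≤ (√(α x))⁻¹ := by linarith [h.2]
    constructor
    · rwa [← div_eq_mul_inv, div_le_iff₀' (hpos x)] at hlow
    · rwa [← one_div, le_div_iff₀' (hpos x)] at hupp
  refine ⟨ρ, by exact_mod_cast hρ, fun x => ?_, fun x => ?_⟩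
  · have hsq : α x * ρ x = √(α x) * (√(α x) * ρ x) := by
      rw [← mul_assoc, Real.mul_self_sqrt (hα₀ x).le]
    rw [hsq]
    nlinarith [hpos x, (hρ' x).1]
  · calc α x * ρ x ^ 2 = (√(α x) * ρ x) ^ 2 := by rw [mul_pow, Real.sq_sqrt (hα₀ x).le]
      _ ≤ 1 := pow_le_one₀ (by linarith [(hρ' x).1]) (hρ' x).2

theorem hasSlowCutoffs_of_lintegral_sqrt_eq_top (hα : Continuous α) (hα₀ : ∀ x, 0 < α x)
    (hleft : ∫⁻ t in Iic (0 : ℝ), ENNReal.ofReal √(α t) = ⊤)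
    (hright : ∫⁻ t in Ici (0 : ℝ), ENNReal.ofReal √(α t) = ⊤) : HasSlowCutoffs α := by
  obtain ⟨ρ, hρ, hρ_low, hρ_upp⟩ := exists_contDiff_approx_inv_sqrt hα hα₀
  have hk : Continuous fun x => α x * ρ x := hα.mul hρ.continuous
  have hk₀ (x : ℝ) : 0 ≤ α x * ρ x := by linarith [hρ_low x, Real.sqrt_nonneg (α x)]
  have htop := tendsto_integral_atTop_of_lintegral_Ici_eq_top hk.locallyIntegrable hk₀
    (lintegral_ofReal_eq_top_of_le_mul hk zero_le_two hρ_low hright)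
  have hbot := tendsto_integral_atBot_of_lintegral_Iic_eq_top hk.locallyIntegrable hk₀
    (lintegral_ofReal_eq_top_of_le_mul hk zero_le_two hρ_low hleft)
  exact hasSlowCutoffs_of_hasDerivAt hα hρ hρ_upp
    (fun x => (hk.integral_hasStrictDerivAt 0 x).hasDerivAt) hbot htop

end Cutoff

section Coefficients

open scoped ComplexConjugate

variable {p p₀ Q r s k y : ℝ → ℝ}

theorem MemL2Loc.congr_ae (hk : MemL2Loc k) (h : k =ᵐ[volume] y) : MemL2Loc y :=
  fun K hK => (memLp_congr_ae (ae_restrict_of_ae h)).1 (hk K hK)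

theorem MemL2Loc.mul_continuous (hk : MemL2Loc k) (hy : Continuous y) :
    MemL2Loc fun x => k x * y x := by
  intro K hK
  obtain ⟨C, hC⟩ := hK.exists_bound_of_continuousOn hy.continuousOn
  refine (hk K hK).of_le_mul (c := C)
    ((hk K hK).aestronglyMeasurable.mul hy.aestronglyMeasurable) ?_
  filter_upwards [ae_restrict_mem hK.measurableSet] with x hx
  rw [norm_mul, mul_comm]
  exact mul_le_mul_of_nonneg_right (hC x hx) (norm_nonneg _)

theorem MemL2Loc.locallyIntegrable_mul (hk : MemL2Loc k) (hy : MemL2Loc y) :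
    LocallyIntegrable (fun x => k x * y x) volume :=
  locallyIntegrable_iff.2 fun K hK => (hk K hK).integrable_mul (hy K hK)

theorem locallyIntegrable_mul_div_of_memL2Loc (hp : ∀ᵐ x, 0 ≤ p x)
    (hk : MemL2Loc fun x => k x / √|p x|) (hy : MemL2Loc fun x => y x / √|p x|) :
    LocallyIntegrable (fun x => k x * y x / p x) volume := by
  refine (hk.locallyIntegrable_mul hy).congr ?_
  filter_upwards [hp] with x hx
  rw [div_mul_div_comm, Real.mul_self_sqrt (abs_nonneg _), abs_of_nonneg hx]

theorem memL2Loc_div_of_continuous (hp : Continuous p) (hpos : ∀ x, 0 < p x)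
    (hk : MemL2Loc fun x => k x / √|p x|) : MemL2Loc fun x => k x / p x := by
  have hsqrt : Continuous fun x => (√(p x))⁻¹ :=
    hp.sqrt.inv₀ fun x => (Real.sqrt_pos.2 (hpos x)).ne'
  refine (hk.mul_continuous hsqrt).congr_ae (Eventually.of_forall fun x => ?_)
  simp only [abs_of_pos (hpos x)]
  rw [← div_eq_mul_inv, div_div, Real.mul_self_sqrt (hpos x).le]

/-- The coefficient `β = (Q + i r) / p` of the first order system of `l[u] = g`. -/
def betaCoeff (p Q r : ℝ → ℝ) (x : ℝ) : ℂ := ((Q x : ℂ) + Complex.I * r x) / p x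

/-- The coefficient `γ = (Q² + r²) / p - s` of the first order system of `l[u] = g`. -/
def gammaCoeff (p Q r s : ℝ → ℝ) (x : ℝ) : ℝ := (Q x ^ 2 + r x ^ 2) / p x - s x

theorem re_betaCoeff (p Q r : ℝ → ℝ) (x : ℝ) : (betaCoeff p Q r x).re = Q x / p x := by
  simp [betaCoeff, Complex.div_ofReal_re]

theorem CoeffConditions.locallyIntegrable_inv (h : CoeffConditions p Q r s)
    (hp : ∀ᵐ x, 0 ≤ p x) : LocallyIntegrable (fun x => (p x)⁻¹) volume := by
  simpa only [one_mul, one_div] using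
    locallyIntegrable_mul_div_of_memL2Loc hp h.inv_sqrt h.inv_sqrt

theorem CoeffConditions.locallyIntegrable_betaCoeff (h : CoeffConditions p Q r s)
    (hp : ∀ᵐ x, 0 ≤ p x) : LocallyIntegrable (betaCoeff p Q r) volume := by
  have hcoe {k : ℝ → ℝ} (hk : LocallyIntegrable k volume) :
      LocallyIntegrable (fun x => (k x : ℂ)) volume :=
    locallyIntegrable_iff.2 fun K hK => (locallyIntegrable_iff.1 hk K hK).ofReal
  have hQ := hcoe (locallyIntegrable_mul_div_of_memL2Loc hp h.Q_div_sqrt h.inv_sqrt)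
  have hr := hcoe (locallyIntegrable_mul_div_of_memL2Loc hp h.r_div_sqrt h.inv_sqrt)
  refine (hQ.add (hr.smul Complex.I)).congr (Eventually.of_forall fun x => ?_)
  simp only [Pi.add_apply, Pi.smul_apply, smul_eq_mul, betaCoeff]
  push_cast
  ring

theorem CoeffConditions.locallyIntegrable_gammaCoeff (h : CoeffConditions p Q r s)
    (hp : ∀ᵐ x, 0 ≤ p x) : LocallyIntegrable (gammaCoeff p Q r s) volume := by
  refine (((locallyIntegrable_mul_div_of_memL2Loc hp h.Q_div_sqrt h.Q_div_sqrt).add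
    (locallyIntegrable_mul_div_of_memL2Loc hp h.r_div_sqrt h.r_div_sqrt)).sub h.s_loc).congr
    (Eventually.of_forall fun x => ?_)
  simp only [Pi.add_apply, Pi.sub_apply, gammaCoeff]
  ring

theorem isMaximalPair_iff_isL2Solution (hp : ∀ᵐ x, p x ≠ 0) {f g : L2} :
    IsMaximalPair p Q r s f g ↔
      IsL2Solution (fun x => (p x)⁻¹) (betaCoeff p Q r) (gammaCoeff p Q r s) f g := by
  have hfst (u v : ℝ → ℂ) : v =ᵐ[volume] quasiDeriv₁ p Q r u ↔
      deriv u =ᵐ[volume] fun x => ((p x)⁻¹ : ℝ) * v x + betaCoeff p Q r x * u x :=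
    eventually_congr <| hp.mono fun x hx => by
      have hx' : (p x : ℂ) ≠ 0 := Complex.ofReal_ne_zero.2 hx
      simp only [quasiDeriv₁, betaCoeff]
      rw [Complex.ofReal_inv, inv_mul_eq_div, div_mul_eq_mul_div,
        ← add_div, eq_div_iff hx', mul_comm (deriv u x), eq_sub_iff_add_eq, eq_comm]
  have hsnd (u v : ℝ → ℂ) : (g =ᵐ[volume] fun x => -quasiDeriv₂ p Q r s u v x) ↔
      deriv v =ᵐ[volume]
        fun x => -(conj (betaCoeff p Q r x)) * v x - (gammaCoeff p Q r s x : ℂ) * u x - g x :=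
    eventually_congr <| Eventually.of_forall fun x => by
      have hβ : conj (betaCoeff p Q r x) = ((Q x : ℂ) - Complex.I * r x) / p x := by
        simp only [betaCoeff, map_div₀, map_add, map_mul, Complex.conj_ofReal, Complex.conj_I]
        ring
      simp only [quasiDeriv₂, hβ, gammaCoeff]
      push_cast
      constructor <;> intro h <;> linear_combination h
  constructor
  · rintro ⟨u, v, hu, hv, hf, h₁, h₂⟩
    exact ⟨u, v, ⟨isPrimitive_iff.2 ⟨hu, (hfst u v).1 h₁⟩,
      isPrimitive_iff.2 ⟨hv, (hsnd u v).1 h₂⟩⟩, hf⟩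
  · rintro ⟨u, v, huv, hf⟩
    exact ⟨u, v, huv.fst.acLoc, huv.snd.acLoc, hf, (hfst u v).2 huv.fst.deriv_ae,
      (hsnd u v).2 huv.snd.deriv_ae⟩

theorem maximalOp_congr_ae (hp : p =ᵐ[volume] p₀) : maximalOp p Q r s = maximalOp p₀ Q r s := by
  have h₁ (u : ℝ → ℂ) : quasiDeriv₁ p Q r u =ᵐ[volume] quasiDeriv₁ p₀ Q r u :=
    hp.mono fun x hx => by simp only [quasiDeriv₁, hx]
  have h₂ (u v : ℝ → ℂ) : (fun x => -quasiDeriv₂ p Q r s u v x) =ᵐ[volume]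
      fun x => -quasiDeriv₂ p₀ Q r s u v x :=
    hp.mono fun x hx => by simp only [quasiDeriv₂, hx]
  refine LinearPMap.eq_of_eq_graph (SetLike.ext fun z => ?_)
  rw [← Prod.mk.eta (p := z), mem_graph_maximalOp, mem_graph_maximalOp]
  simp only [IsMaximalPair, (h₁ _).congr_right, (h₂ _ _).congr_right]

theorem CoeffConditions.congr_ae (h : CoeffConditions p Q r s) (hp : p =ᵐ[volume] p₀) :
    CoeffConditions p₀ Q r s where
  inv_sqrt := h.inv_sqrt.congr_ae (hp.mono fun x hx => by simp only [hx])
  Q_div_sqrt := h.Q_div_sqrt.congr_ae (hp.mono fun x hx => by simp only [hx])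
  r_div_sqrt := h.r_div_sqrt.congr_ae (hp.mono fun x hx => by simp only [hx])
  s_loc := h.s_loc
  inv_ne_zero := by
    filter_upwards [h.inv_ne_zero, hp] with x h₁ h₂
    rwa [← h₂]

theorem mem_graph_preminimalOp {f g : L2} :
    (f, g) ∈ (preminimalOp p Q r s).graph ↔
      IsMaximalPair p Q r s f g ∧ f ∈ compactlySupported := by
  rw [← mem_graph_maximalOp, preminimalOp]
  constructor
  · intro h
    obtain ⟨y, rfl, rfl⟩ := (LinearPMap.mem_graph_iff _).1 h
    exact ⟨LinearPMap.le_graph_of_le LinearPMap.domRestrict_le h, y.2.1⟩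
  · rintro ⟨h, hf⟩
    obtain ⟨y, rfl, rfl⟩ := (LinearPMap.mem_graph_iff _).1 h
    exact (LinearPMap.mem_graph_iff _).2 ⟨⟨y, hf, y.2⟩, rfl, LinearPMap.domRestrict_apply rfl⟩

theorem CoeffConditions.ne_zero (h : CoeffConditions p Q r s) : ∀ᵐ x, p x ≠ 0 :=
  h.inv_ne_zero.mono fun _ hx hp => hx (by rw [hp, div_zero])

theorem adjoint_graph_preminimalOp (h : CoeffConditions p Q r s) (hp : ∀ᵐ x, 0 ≤ p x) :
    (preminimalOp p Q r s).graph.adjoint = (maximalOp p Q r s).graph := by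
  have hα₀ : ∀ᵐ x, (p x)⁻¹ ≠ 0 := h.ne_zero.mono fun _ => inv_ne_zero
  ext ⟨f, g⟩
  rw [mem_graph_maximalOp, isMaximalPair_iff_isL2Solution h.ne_zero, Submodule.mem_adjoint_iff]
  simp only [mem_graph_preminimalOp, isMaximalPair_iff_isL2Solution h.ne_zero, and_imp, sub_eq_zero]
  exact ⟨fun hfg => IsWeakL2Solution.isL2Solution (h.locallyIntegrable_inv hp)
      (h.locallyIntegrable_betaCoeff hp) (h.locallyIntegrable_gammaCoeff hp) hα₀ hfg,
    fun hfg => hfg.isWeakL2Solution hα₀⟩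

theorem isLowerBound_of_preminimalOp (hp : ∀ᵐ x, p x ≠ 0) {c : ℝ}
    (hc : ∀ u : (preminimalOp p Q r s).domain,
      c * ‖(u : L2)‖ ^ 2 ≤ (inner ℂ (preminimalOp p Q r s u) (u : L2)).re) :
    IsLowerBound (fun x => (p x)⁻¹) (betaCoeff p Q r) (gammaCoeff p Q r s) c := by
  intro F G hFG hF
  obtain ⟨u, rfl, rfl⟩ := (LinearPMap.mem_graph_iff _).1 <|
    mem_graph_preminimalOp.2 ⟨(isMaximalPair_iff_isL2Solution hp).2 hFG, hF⟩
  exact hc u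

theorem hasSlowCutoffs_inv (hp : Continuous p) (hpos : ∀ x, 0 < p x)
    (hleft : ∫⁻ t in Iic (0 : ℝ), ENNReal.ofReal (p t ^ (-(1 / 2) : ℝ)) = ⊤)
    (hright : ∫⁻ t in Ici (0 : ℝ), ENNReal.ofReal (p t ^ (-(1 / 2) : ℝ)) = ⊤) :
    HasSlowCutoffs fun x => (p x)⁻¹ := by
  have hsqrt (x : ℝ) : p x ^ (-(1 / 2) : ℝ) = √(p x)⁻¹ := by
    rw [Real.rpow_neg (hpos x).le, ← Real.sqrt_eq_rpow, Real.sqrt_inv]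
  simp only [hsqrt] at hleft hright
  exact hasSlowCutoffs_of_lintegral_sqrt_eq_top (hp.inv₀ fun x => (hpos x).ne')
    (fun x => inv_pos.2 (hpos x)) hleft hright

theorem topologicalClosure_graph_preminimalOp (h : CoeffConditions p Q r s) (hp : Continuous p)
    (hpos : ∀ x, 0 < p x)
    (hleft : ∫⁻ t in Iic (0 : ℝ), ENNReal.ofReal (p t ^ (-(1 / 2) : ℝ)) = ⊤)
    (hright : ∫⁻ t in Ici (0 : ℝ), ENNReal.ofReal (p t ^ (-(1 / 2) : ℝ)) = ⊤)
    (hbdd : BoundedBelow (preminimalOp p Q r s)) :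
    (preminimalOp p Q r s).graph.topologicalClosure = (maximalOp p Q r s).graph := by
  obtain ⟨c, hc⟩ := hbdd
  have hadj := adjoint_graph_preminimalOp h (Eventually.of_forall fun x => (hpos x).le)
  have hlow := isLowerBound_of_preminimalOp h.ne_zero hc
  rw [← hadj]
  refine topologicalClosure_eq_adjoint_of_ker ?_ (sub_one_lt c) ?_ fun f hf => ?_
  · exact hadj ▸ LinearPMap.le_graph_of_le LinearPMap.domRestrict_le
  · rintro ⟨F, G⟩ hFG
    obtain ⟨u, rfl, rfl⟩ := (LinearPMap.mem_graph_iff _).1 hFG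
    exact hc u
  · rw [hadj, mem_graph_maximalOp, isMaximalPair_iff_isL2Solution h.ne_zero] at hf
    refine hlow.eq_zero_of_isL2Solution_smul (hp.inv₀ fun x => (hpos x).ne')
      (fun x => (inv_pos.2 (hpos x)).le) ?_ (sub_one_lt c)
      (hasSlowCutoffs_inv hp hpos hleft hright) hf
    simpa only [re_betaCoeff] using memL2Loc_div_of_continuous hp hpos h.Q_div_sqrt

end Coefficients

end SturmLiouville

end

theorem theorem1_general (p Q r s : ℝ → ℝ)
    (hcoeff : SturmLiouville.CoeffConditions p Q r s)
    (hpos : ∃ p₀ : ℝ → ℝ, Continuous p₀ ∧ p =ᵐ[volume] p₀ ∧ ∀ x, 0 < p₀ x)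
    (hleft : ∫⁻ t in Set.Iic (0 : ℝ), ENNReal.ofReal (p t ^ (-(1 / 2) : ℝ)) = ⊤)
    (hright : ∫⁻ t in Set.Ici (0 : ℝ), ENNReal.ofReal (p t ^ (-(1 / 2) : ℝ)) = ⊤)
    (hbdd : SturmLiouville.BoundedBelow (SturmLiouville.preminimalOp p Q r s)) :
    SturmLiouville.EssentiallySelfAdjoint (SturmLiouville.preminimalOp p Q r s) ∧
      (SturmLiouville.preminimalOp p Q r s).adjoint = SturmLiouville.maximalOp p Q r s ∧
      SturmLiouville.maximalOp p Q r s = (SturmLiouville.maximalOp p Q r s).adjoint := by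
  obtain ⟨p₀, hp₀, hpp₀, hp₀_pos⟩ := hpos
  have hlintegral (S : Set ℝ) : ∫⁻ t in S, ENNReal.ofReal (p t ^ (-(1 / 2) : ℝ)) =
      ∫⁻ t in S, ENNReal.ofReal (p₀ t ^ (-(1 / 2) : ℝ)) :=
    lintegral_congr_ae (ae_restrict_of_ae (hpp₀.mono fun x hx => by simp only [hx]))
  rw [hlintegral] at hleft hright
  simp only [SturmLiouville.preminimalOp, SturmLiouville.maximalOp_congr_ae hpp₀] at hbdd ⊢
  have hcoeff₀ := hcoeff.congr_ae hpp₀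
  exact SturmLiouville.essentiallySelfAdjoint_of_topologicalClosure_eq
    (SturmLiouville.adjoint_graph_preminimalOp hcoeff₀
      (Eventually.of_forall fun x => (hp₀_pos x).le))
    (SturmLiouville.topologicalClosure_graph_preminimalOp hcoeff₀ hp₀ hp₀_pos hleft hright hbdd)

theorem theorem1 (p Q r s : ℝ → ℝ)
    (hcoeff : SturmLiouville.CoeffConditions p Q r s)
    (hp : SturmLiouville.MemW12Loc p)
    -- `p > 0`, for the continuous representative of `p`
    (hpos : ∃ p₀ : ℝ → ℝ, Continuous p₀ ∧ p =ᵐ[volume] p₀ ∧ ∀ x, 0 < p₀ x)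
    (hleft : ∫⁻ t in Set.Iic (0 : ℝ), ENNReal.ofReal (p t ^ (-(1 / 2) : ℝ)) = ⊤)
    (hright : ∫⁻ t in Set.Ici (0 : ℝ), ENNReal.ofReal (p t ^ (-(1 / 2) : ℝ)) = ⊤)
    (hbdd : SturmLiouville.BoundedBelow (SturmLiouville.preminimalOp p Q r s)) :
    SturmLiouville.EssentiallySelfAdjoint (SturmLiouville.preminimalOp p Q r s) ∧
      (SturmLiouville.preminimalOp p Q r s).adjoint = SturmLiouville.maximalOp p Q r s ∧
      SturmLiouville.maximalOp p Q r s = (SturmLiouville.maximalOp p Q r s).adjoint :=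
  theorem1_general p Q r s hcoeff hpos hleft hright hbdd
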